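/- **Setting.** Let $S$ be a finite set with $|S|\ge 3$, partitioned into white and black elements, with at least two white elements; let $k$ be a commutative ring. A 2-partition of $S$ is an unordered pair of complementary subsets; it is *stable* if each part has at least two elements and contains a white one. For subsets, or lists of elements, $X,Y$ write $X\sigma Y$ if $X$ lies in one part of $\sigma$ and $Y$ in the other. A quadruple of pairwise distinct $i,j,k,l\in S$ is *allowed* if each of the sets $\{i,j\},\{k,l\},\{k,j\},\{i,l\}$ contains a white element. *Cohomology.* Let $\mathcal R_S=k[l_\sigma]$ be the polynomial ring on variables indexed by the stable 2-partitions of $S$, and let $I_S$ be the ideal generated by $\sum_{\sigma:\,ij\sigma kl}l_\sigma-\sum_{\sigma:\,kj\sigma il}l_\sigma$, for all allowed $i,j,k,l$, and by $l_\sigma l_{\sigma'}$, for all $\sigma,\sigma'$ such that $ij\sigma kl$ and $kj\sigma' il$ for some allowed $i,j,k,l$. Put $H^*_S=\mathcal R_S/I_S$. *Trees.* An $S$-tree is a finite tree with tails bijectively labelled by $S$; a flag is a tail or a half-edge, and $F_\tau(v)$ is the set of flags at the vertex $v$. An $S$-tree is *painted stable* if every vertex has at least three flags and every vertex incident to at most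 one edge carries a white tail. The branch starting with a flag $f\in F_\tau(v)$ is the component containing $f$ after $v$ is removed; it carries a subset of $S$. Deleting an edge $e$ splits $S$ into a stable 2-partition $\sigma_e$. Put $m(\tau)=\prod_e l_{\sigma_e}\in\mathcal R_S$ (a *good monomial*). A *stable 2-partition $\alpha$ of $F_\tau(v)$* is an unordered 2-partition whose parts each contain at least two flags and each have a white label on at least one of their branches; $\tau(\alpha)$ is the painted stable $S$-tree obtained by replacing $v$ by two vertices joined by a new edge and distributing the flags at $v$ according to $\alpha$, and $\sigma_\alpha$ is the 2-partition of $S$ defined by this new edge. A quadruple of flags $I,J,K,L$ is *allowed* if there are labels $i,j,k,l$ on the branches starting with $I,J,K,L$ respectively that form an allowed quadruple. *Homology.* Let $\mathcal M_S$ be the free $k$-module on generators $\mu(\tau)$ indexed by the isomorphism classes of painted stable $S$-trees (isomorphisms being the identity on $S$). Let $J_S\subset\mathcal M_S$ be spanned by the *standard relations* $$\sum_{\alpha:\,IJ\alpha KL}\mu(\tau(\alpha))-\sum_{\alpha:\,KJ\alpha IL}\mu(\tau(\alpha)),$$ for all $\tau$, all vertices $v$ of $\tau$ and all allowed quadruples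 of pairwise distinct flags $I,J,K,L\in F_\tau(v)$, where $\alpha$ runs over stable 2-partitions of $F_\tau(v)$. Put $H_{*S}=\mathcal M_S/J_S$, and write $[\,\cdot\,]$ for classes modulo $I_S$ or $J_S$. **Theorem.** There is exactly one $k$-linear action of the $k$-algebra $H^*_S$ on $H_{*S}$ such that for all $\sigma$ and $\tau$: 1. if $\sigma\ne\sigma_e$ for every edge $e$ of $\tau$ and $\sigma\neq\sigma_\alpha$ for every stable 2-partition $\alpha$ of the flags at a vertex of $\tau$, then $l_\sigma[\mu(\tau)]=0$; 2. if $\sigma=\sigma_\alpha$ for a stable 2-partition $\alpha$ of the flags at a vertex of $\tau$, then $l_\sigma[\mu(\tau)]=[\mu(\tau(\alpha))]$; 3. if $\sigma=\sigma_e$ for an edge $e$ of $\tau$ with halves $e_1,e_2$ at its ends $v_1,v_2$, then for every choice of distinct $I,J\in F_\tau(v_1)\setminus\{e_1\}$ and distinct $K,L\in F_\tau(v_2)\setminus\{e_2\}$ such that $I,J,K,L$ is allowed, $$l_\sigma[\mu(\tau)]=-\sum_{\alpha:\,IJ\alpha e_1}[\mu(\tau(\alpha))]-\sum_{\beta:\,e_2\beta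 KL}[\mu(\tau(\beta))],$$ where $\alpha$ (resp. $\beta$) runs over stable 2-partitions of $F_\tau(v_1)$ (resp. $F_\tau(v_2)$). Moreover, with this action $H_{*S}$ is a free $H^*_S$-module of rank one generated by the class $\mathbf 1$ of the one-vertex tree, that is, $a\mapsto a\mathbf 1$ is a bijection $H^*_S\to H_{*S}$. Finally, the standard relations span all linear relations between the classes of good monomials in $H^*_S$: the kernel of the $k$-linear map $\mathcal M_S\to H^*_S$, $\mu(\tau)\mapsto[m(\tau)]$, is exactly $J_S$. -/

import Mathlib

universe u v

namespace PaintedTrees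

/-- A finite graph given by vertices, flags, a boundary map and an involution of the flags,
together with a marking: a bijection of `S` with the set of tails (the flags fixed by the
involution). The edges are the two-element orbits of the involution. -/
structure SGraph (S : Type u) where
  V : Type u
  F : Type u
  finite_V : Finite V
  finite_F : Finite F
  bd : F → V
  inv : F → F
  inv_inv : ∀ f, inv (inv f) = f
  label : S ≃ {f : F // inv f = f}

namespace SGraph

variable {S : Type u}

/-- Two vertices are the two ends of some edge (or `u = w` carries a tail). -/
def Step (G : SGraph S) (u w : G.V) : Prop :=
  ∃ g, G.bd g = u ∧ G.bd (G.inv g) = w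

/-- The same after deletion of the interior of the edge `{f, inv f}`. -/
def StepOff (G : SGraph S) (f : G.F) (u w : G.V) : Prop :=
  ∃ g, g ≠ f ∧ g ≠ G.inv f ∧ G.bd g = u ∧ G.bd (G.inv g) = w

/-- Being connected in the graph with the interior of the edge `{f, inv f}` deleted. -/
def ReachOff (G : SGraph S) (f : G.F) : G.V → G.V → Prop :=
  Relation.ReflTransGen (G.StepOff f)

/-- A tree: a nonempty connected graph without cycles (loops and multiple edges included),
that is, deleting the interior of any edge disconnects the two ends of this edge. -/
structure IsTree (G : SGraph S) : Prop where
  nonempty : Nonempty G.V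
  connected : ∀ u w, Relation.ReflTransGen G.Step u w
  bridge : ∀ f, G.inv f ≠ f → ¬ G.ReachOff f (G.bd f) (G.bd (G.inv f))

/-- The labels on the branch that starts with the flag `f`: if `f` is a tail this is its
label; if `f` is a half of an edge, these are the labels of the tails which lie in the
component of the other end of this edge after the interior of the edge is deleted. -/
def branch (G : SGraph S) (f : G.F) : Set S :=
  {s | (G.label s : G.F) = f ∨
    (G.inv f ≠ f ∧ G.ReachOff f (G.bd (G.inv f)) (G.bd (G.label s)))}

/-- An isomorphism of graphs which is the identity on `S`. -/
structure Iso (G H : SGraph S) where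
  onV : G.V ≃ H.V
  onF : G.F ≃ H.F
  bd_eq : ∀ f, H.bd (onF f) = onV (G.bd f)
  inv_eq : ∀ f, H.inv (onF f) = onF (G.inv f)
  label_eq : ∀ s, (H.label s : H.F) = onF (G.label s)

/-- A painted stable tree; `W` is the set of white labels, its complement is the set of black
ones. Every vertex has at least three flags, and every end vertex (a vertex incident to at most
one edge) carries a white tail. -/
structure IsPaintedStable (W : Set S) (G : SGraph S) : Prop where
  tree : G.IsTree
  stable : ∀ x, 3 ≤ {f | G.bd f = x}.ncard
  white : ∀ x, {f | G.bd f = x ∧ G.inv f ≠ f}.Subsingleton → ∃ s ∈ W, G.bd (G.label s) = x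

/-- The edges, as unordered pairs of flags. -/
def Edge (G : SGraph S) : Type u :=
  {e : Sym2 G.F // ∃ f, G.inv f ≠ f ∧ e = s(f, G.inv f)}

/-- The edge that contains a given flag `f` which is not a tail. -/
def edgeOf (G : SGraph S) (f : G.F) (hf : G.inv f ≠ f) : G.Edge := ⟨s(f, G.inv f), f, hf, rfl⟩

open Classical in
/-- Replace a vertex `x` by two vertices joined by a new edge, the flags at `x` which
lie in `A` being moved to the first one (`none`), the others staying at the second
one (`some x`). -/
noncomputable def split (G : SGraph S) (x : G.V) (A : Set G.F) : SGraph S where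
  V := Option G.V
  F := G.F ⊕ Bool
  finite_V := by have := G.finite_V; infer_instance
  finite_F := by have := G.finite_F; infer_instance
  bd := Sum.elim (fun f => if f ∈ A then none else some (G.bd f))
    (fun b => if b then none else some x)
  inv := Sum.map G.inv not
  inv_inv := by rintro (f | b) <;> simp [G.inv_inv]
  label := Equiv.ofBijective
    (fun s => ⟨Sum.inl (G.label s), by simp [(G.label s).2]⟩)
    ⟨fun s t h => G.label.injective (Subtype.ext (Sum.inl.inj (congrArg Subtype.val h))), by
      rintro ⟨f | b, h⟩
      · refine ⟨G.label.symm ⟨f, Sum.inl.inj h⟩, ?_⟩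
        simp
      · cases b <;> simp at h⟩

/-- The graph with one vertex, no edges, and tails labelled by `S`. -/
def point (S : Type u) [Finite S] : SGraph S where
  V := PUnit
  F := S
  finite_V := inferInstance
  finite_F := inferInstance
  bd := fun _ => PUnit.unit
  inv := id
  inv_inv := fun _ => rfl
  label := ⟨fun s => ⟨s, rfl⟩, fun f => f.1, fun _ => rfl, fun _ => rfl⟩

theorem StepOff.symm {G : SGraph S} {f : G.F} {a b : G.V} (h : G.StepOff f a b) :
    G.StepOff f b a := by
  obtain ⟨g, h1, h2, h3, h4⟩ := h
  refine ⟨G.inv g, ?_, ?_, h4, by rw [G.inv_inv]; exact h3⟩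
  · intro h; exact h2 (by rw [← h, G.inv_inv])
  · intro h; exact h1 (by rw [← G.inv_inv g, h, G.inv_inv])

theorem ReachOff.symm {G : SGraph S} {f : G.F} {a b : G.V} (h : G.ReachOff f a b) :
    G.ReachOff f b a := by
  induction h with
  | refl => exact .refl
  | tail _ h ih => exact Relation.ReflTransGen.head h.symm ih

theorem stepOff_inv (G : SGraph S) (f : G.F) : G.StepOff (G.inv f) = G.StepOff f := by
  funext a b
  simp only [StepOff, G.inv_inv]
  apply propext
  constructor <;> (rintro ⟨g, h1, h2, h3⟩; exact ⟨g, h2, h1, h3⟩)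

theorem reachOff_inv (G : SGraph S) (f : G.F) : G.ReachOff (G.inv f) = G.ReachOff f := by
  unfold ReachOff; rw [stepOff_inv]

theorem inv_ne {G : SGraph S} {f : G.F} (hf : G.inv f ≠ f) : G.inv (G.inv f) ≠ G.inv f := by
  rw [G.inv_inv]; exact hf.symm

theorem IsTree.cover {G : SGraph S} (hG : G.IsTree) (f : G.F) (x : G.V) :
    G.ReachOff f (G.bd f) x ∨ G.ReachOff f (G.bd (G.inv f)) x := by
  induction hG.connected (G.bd f) x with
  | refl => exact Or.inl .refl
  | @tail y z _ h ih =>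
    obtain ⟨g, rfl, rfl⟩ := h
    by_cases h1 : g = f
    · subst h1; exact Or.inr .refl
    by_cases h2 : g = G.inv f
    · subst h2; rw [G.inv_inv]; exact Or.inl .refl
    have st : G.StepOff f (G.bd g) (G.bd (G.inv g)) := ⟨g, h1, h2, rfl, rfl⟩
    exact ih.imp (fun h => h.tail st) (fun h => h.tail st)

theorem mem_branch_edge {G : SGraph S} {f : G.F} (hf : G.inv f ≠ f) (s : S) :
    s ∈ G.branch f ↔ G.ReachOff f (G.bd (G.inv f)) (G.bd (G.label s)) := by
  constructor
  · rintro (h | h)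
    · exact absurd (h ▸ (G.label s).2) hf
    · exact h.2
  · exact fun h => Or.inr ⟨hf, h⟩

theorem IsTree.branch_inv {G : SGraph S} (hG : G.IsTree) {f : G.F} (hf : G.inv f ≠ f) :
    G.branch (G.inv f) = (G.branch f)ᶜ := by
  ext s
  rw [Set.mem_compl_iff, mem_branch_edge hf, mem_branch_edge (inv_ne hf), G.inv_inv,
    reachOff_inv]
  constructor
  · intro h1 h2
    exact hG.bridge f hf (Relation.ReflTransGen.trans h1 h2.symm)
  · intro h
    exact (hG.cover f _).resolve_right h

theorem IsTree.side_subset {G : SGraph S} (hG : G.IsTree) {f g : G.F} (hf : G.inv f ≠ f)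
    (hg : G.inv g ≠ g) (hgf : G.bd g = G.bd (G.inv f)) (hne : g ≠ G.inv f) (x : G.V)
    (hx : G.ReachOff g (G.bd (G.inv g)) x) : G.ReachOff f (G.bd (G.inv f)) x := by
  have hw : ¬ G.ReachOff g (G.bd (G.inv g)) (G.bd (G.inv f)) := by
    rw [← hgf]; exact fun h => hG.bridge g hg h.symm
  induction hx with
  | refl =>
    refine .single ⟨g, ?_, hne, hgf, rfl⟩
    rintro rfl
    exact hG.bridge g hf (by rw [← hgf]; exact .refl)
  | @tail y z h1 h2 ih =>
    obtain ⟨h, a, b, rfl, rfl⟩ := h2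
    by_cases c1 : h = f
    · subst c1
      exact absurd (h1.tail ⟨h, a, b, rfl, rfl⟩) hw
    by_cases c2 : h = G.inv f
    · subst c2
      exact absurd h1 hw
    exact ih.tail ⟨h, c1, c2, rfl, rfl⟩

end SGraph

variable {S : Type u}

/-- A part of a painted stable 2-partition has at least two elements and contains a white one. -/
def StablePart (W A : Set S) : Prop := A.Nontrivial ∧ (A ∩ W).Nonempty

/-- Painted stable unordered 2-partitions of `S`. -/
def StablePartition (W : Set S) : Type u :=
  {σ : Sym2 (Set S) // ∃ A, σ = s(A, Aᶜ) ∧ StablePart W A ∧ StablePart W Aᶜ}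

/-- `ij σ kl`: the labels `i, j` lie in one part of `σ` and `k, l` lie in the other one. -/
def StablePartition.Separates {W : Set S} (σ : StablePartition W) (i j k l : S) : Prop :=
  ∃ A : Set S, σ.1 = s(A, Aᶜ) ∧ i ∈ A ∧ j ∈ A ∧ k ∉ A ∧ l ∉ A

/-- Allowed quadruples of labels: `i, j, k, l` are pairwise distinct and both
partitions `ij|kl` and `kj|il` of the set `{i, j, k, l}` are painted stable. -/
structure Allowed (W : Set S) (i j k l : S) : Prop where
  distinct : [i, j, k, l].Nodup
  left_ij : i ∈ W ∨ j ∈ W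
  left_kl : k ∈ W ∨ l ∈ W
  right_kj : k ∈ W ∨ j ∈ W
  right_il : i ∈ W ∨ l ∈ W

/-- Painted stable `S`-trees. -/
structure PSTree (W : Set S) where
  graph : SGraph S
  stable : graph.IsPaintedStable W

open SGraph

theorem PSTree.stablePart_branch {W : Set S} (τ : PSTree W) (f : τ.graph.F)
    (hf : τ.graph.inv f ≠ f) : StablePart W (τ.graph.branch f) := by
  obtain ⟨G, hG⟩ := τ
  simp only at f hf ⊢
  have := G.finite_V
  have := G.finite_F
  suffices H : ∀ (n : ℕ) (f : G.F), G.inv f ≠ f →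
      {x | G.ReachOff f (G.bd (G.inv f)) x}.ncard ≤ n → StablePart W (G.branch f) from
    H _ f hf le_rfl
  intro n
  induction n with
  | zero =>
    intro f hf hn
    have h0 := (Set.ncard_eq_zero (Set.toFinite _)).1 (Nat.le_zero.1 hn)
    have : G.bd (G.inv f) ∈ {x | G.ReachOff f (G.bd (G.inv f)) x} := .refl
    rw [h0] at this
    exact absurd this (Set.notMem_empty _)
  | succ n ih =>
    intro f hf hn
    by_cases h : ∃ g, G.bd g = G.bd (G.inv f) ∧ g ≠ G.inv f ∧ G.inv g ≠ g
    · obtain ⟨g, hgf, hne, hg⟩ := h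
      have sub := hG.tree.side_subset hf hg hgf hne
      have lt : {x | G.ReachOff g (G.bd (G.inv g)) x}.ncard <
          {x | G.ReachOff f (G.bd (G.inv f)) x}.ncard := by
        refine Set.ncard_lt_ncard ⟨fun x hx => sub x hx, fun h => ?_⟩ (Set.toFinite _)
        have : G.ReachOff g (G.bd (G.inv g)) (G.bd (G.inv f)) := h (a := G.bd (G.inv f)) .refl
        rw [← hgf] at this
        exact hG.tree.bridge g hg this.symm
      have hsub : G.branch g ⊆ G.branch f := by
        intro s hs
        rw [mem_branch_edge hg] at hs
        rw [mem_branch_edge hf]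
        exact sub _ hs
      obtain ⟨h1, h2⟩ := ih g hg (by omega)
      exact ⟨h1.mono hsub, h2.mono (Set.inter_subset_inter_left _ hsub)⟩
    · push Not at h
      have hmem : ∀ s, G.bd (G.label s) = G.bd (G.inv f) → s ∈ G.branch f := by
        intro s hs
        rw [mem_branch_edge hf, hs]
        exact .refl
      obtain ⟨s, hsW, hs⟩ := hG.white (G.bd (G.inv f)) (by
        rintro a ⟨ha, ha'⟩ b ⟨hb, hb'⟩
        have e1 : a = G.inv f := by
          by_contra hne
          exact ha' (h a ha hne)
        have e2 : b = G.inv f := by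
          by_contra hne
          exact hb' (h b hb hne)
        rw [e1, e2])
      refine ⟨?_, ⟨s, hmem s hs, hsW⟩⟩
      have h3 := hG.stable (G.bd (G.inv f))
      have : ∃ t ∈ {g | G.bd g = G.bd (G.inv f)}, t ∉ ({G.inv f, (G.label s : G.F)} : Set G.F) := by
        refine Set.exists_mem_notMem_of_ncard_lt_ncard ?_
        have := Set.ncard_insert_le (G.inv f) {(G.label s : G.F)}
        rw [Set.ncard_singleton] at this
        omega
      obtain ⟨t, ht, ht'⟩ := this
      simp only [Set.mem_insert_iff, Set.mem_singleton_iff, not_or] at ht'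
      have htt := h t ht ht'.1
      refine ⟨s, hmem s hs, G.label.symm ⟨t, htt⟩, hmem _ (by simpa using ht), ?_⟩
      intro e
      apply ht'.2
      rw [e]; simp

/-- The painted stable 2-partition of `S` obtained by deleting the interior of an edge. -/
def PSTree.edgePartition {W : Set S} (τ : PSTree W) (e : τ.graph.Edge) : StablePartition W :=
  ⟨e.1.map τ.graph.branch, by
    obtain ⟨_, f, hf, rfl⟩ := e
    refine ⟨τ.graph.branch f, ?_, τ.stablePart_branch f hf, ?_⟩
    · rw [← τ.stable.tree.branch_inv hf]; rfl
    · rw [← τ.stable.tree.branch_inv hf]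
      exact τ.stablePart_branch _ (inv_ne hf)⟩

/-- A painted stable 2-partition `α` of the set of flags at a vertex `x`, presented by one of
its two parts (so each unordered partition is presented twice). Each part contains at
least two flags and has a white label on at least one of its branches; this says precisely that
inserting the corresponding new edge at `x` yields a painted stable tree. -/
structure VertexPartition {W : Set S} (τ : PSTree W) (x : τ.graph.V) where
  part : Set τ.graph.F
  at_vertex : ∀ f ∈ part, τ.graph.bd f = x
  two_in : part.Nontrivial
  two_out : {f | τ.graph.bd f = x ∧ f ∉ part}.Nontrivial
  white_in : ∃ f ∈ part, (τ.graph.branch f ∩ W).Nonempty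
  white_out : ∃ f, τ.graph.bd f = x ∧ f ∉ part ∧ (τ.graph.branch f ∩ W).Nonempty

/-- `IJ α KL`, where the given part of `α` is the one that contains `I, J`. -/
def VertexPartition.Separates {W : Set S} {τ : PSTree W} {x : τ.graph.V}
    (α : VertexPartition τ x) (I J K L : τ.graph.F) : Prop :=
  I ∈ α.part ∧ J ∈ α.part ∧ K ∉ α.part ∧ L ∉ α.part

theorem SGraph.split_isTree {G : SGraph S} (hG : G.IsTree) (x : G.V) (A : Set G.F)
    (hA : ∀ f ∈ A, G.bd f = x) : (G.split x A).IsTree := by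
  classical
  have bdA : ∀ g, g ∈ A → (G.split x A).bd (Sum.inl g) = none := fun g hg => if_pos hg
  have bdN : ∀ g, g ∉ A → (G.split x A).bd (Sum.inl g) = some (G.bd g) := fun g hg => if_neg hg
  have e1 : (G.split x A).Step none (some x) := ⟨Sum.inr true, rfl, rfl⟩
  have e2 : (G.split x A).Step (some x) none := ⟨Sum.inr false, rfl, rfl⟩
  have up : ∀ g, Relation.ReflTransGen (G.split x A).Step ((G.split x A).bd (Sum.inl g))
      (some (G.bd g)) := by
    intro g
    by_cases hg : g ∈ A
    · rw [bdA g hg, hA g hg]; exact .single e1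
    · rw [bdN g hg]; exact .refl
  have dn : ∀ g, Relation.ReflTransGen (G.split x A).Step (some (G.bd g))
      ((G.split x A).bd (Sum.inl g)) := by
    intro g
    by_cases hg : g ∈ A
    · rw [bdA g hg, hA g hg]; exact .single e2
    · rw [bdN g hg]; exact .refl
  have lift : ∀ a b, Relation.ReflTransGen G.Step a b →
      Relation.ReflTransGen (G.split x A).Step (some a) (some b) := by
    intro a b h
    induction h with
    | refl => exact .refl
    | tail _ h ih =>
      obtain ⟨g, rfl, rfl⟩ := h
      exact (ih.trans (dn g)).trans (.head ⟨Sum.inl g, rfl, rfl⟩ (up (G.inv g)))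
  refine ⟨⟨none⟩, ?_, ?_⟩
  · have t1 : ∀ u : Option G.V, Relation.ReflTransGen (G.split x A).Step u (some x) := by
      rintro (_ | u)
      · exact .single e1
      · exact lift _ _ (hG.connected _ _)
    have t2 : ∀ u : Option G.V, Relation.ReflTransGen (G.split x A).Step (some x) u := by
      rintro (_ | u)
      · exact .single e2
      · exact lift _ _ (hG.connected _ _)
    exact fun u w => (t1 u).trans (t2 w)
  · rintro (f | b) hf hR
    · have hf' : G.inv f ≠ f := fun h => hf (congrArg Sum.inl h)
      have pr : ∀ g, ((G.split x A).bd (Sum.inl g) : Option G.V).getD x = G.bd g := by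
        intro g
        by_cases hg : g ∈ A
        · rw [bdA g hg, hA g hg]; rfl
        · rw [bdN g hg]; rfl
      have key : ∀ a b : Option G.V, (G.split x A).ReachOff (Sum.inl f) a b →
          G.ReachOff f (a.getD x) (b.getD x) := by
        intro a b h
        induction h with
        | refl => exact .refl
        | tail _ h ih =>
          obtain ⟨g, h1, h2, rfl, rfl⟩ := h
          rcases g with g | b
          · refine Relation.ReflTransGen.tail ih ⟨g, fun h => h1 (congrArg Sum.inl h),
              fun h => h2 (congrArg Sum.inl h), (pr g).symm, (pr (G.inv g)).symm⟩
          · cases b <;> exact ih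
      have := key _ _ hR
      rw [pr f] at this
      exact hG.bridge f hf' (by rw [← pr (G.inv f)]; exact this)
    · have hR' : (G.split x A).ReachOff (Sum.inr true) none (some x) := by
        cases b
        · have h := hR.symm
          exact (congrFun (congrFun (reachOff_inv (G.split x A) (Sum.inr true)) none)
            (some x)).mp h
        · exact hR
      have key : ∀ w : Option G.V, (G.split x A).ReachOff (Sum.inr true) none w →
          w = none ∨ ∃ a ∈ A, G.inv a ≠ a ∧ ∃ u, w = some u ∧ G.ReachOff a (G.bd (G.inv a)) u := by
        intro w h
        induction h with
        | refl => exact Or.inl rfl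
        | tail _ h ih =>
          obtain ⟨g, h1, h2, h3, rfl⟩ := h
          rcases g with g | b
          · change (G.split x A).bd (Sum.inl (G.inv g)) = none ∨ _
            by_cases hi : G.inv g ∈ A
            · exact Or.inl (bdA _ hi)
            right
            have hw : (G.split x A).bd ((G.split x A).inv (Sum.inl g)) =
                some (G.bd (G.inv g)) := bdN _ hi
            rw [hw]
            rcases ih with rfl | ⟨a, ha, ha', u, rfl, hu⟩
            · have hgA : g ∈ A := by
                by_contra hg
                rw [bdN g hg] at h3
                exact absurd h3 (by simp)
              exact ⟨g, hgA, fun h => hi (by rw [h]; exact hgA), _, rfl, .refl⟩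
            · have hgA : g ∉ A := by
                intro hg
                rw [bdA g hg] at h3
                exact absurd h3 (by simp)
              rw [bdN g hgA] at h3
              have h3 := Option.some.inj h3
              refine ⟨a, ha, ha', _, rfl, hu.tail ⟨g, ?_, ?_, h3, rfl⟩⟩
              · rintro rfl; exact hgA ha
              · rintro rfl; rw [G.inv_inv] at hi; exact hi ha
          · cases b
            · exact absurd rfl h2
            · exact absurd rfl h1
      rcases key _ hR' with h | ⟨a, ha, ha', u, hu, hu'⟩
      · exact absurd h (by simp)
      · obtain rfl := Option.some.inj hu
        rw [← hA a ha] at hu'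
        exact hG.bridge a ha' hu'.symm

theorem SGraph.three_le {F : Type u} [Finite F] {s : Set F} {a b c : F} (ha : a ∈ s) (hb : b ∈ s)
    (hc : c ∈ s) (hab : a ≠ b) (hac : a ≠ c) (hbc : b ≠ c) : 3 ≤ s.ncard :=
  (Set.two_lt_ncard (Set.toFinite s)).2 ⟨a, ha, b, hb, c, hc, hab, hac, hbc⟩

theorem SGraph.branch_tail {G : SGraph S} {f : G.F} {s : S} (hf : G.inv f = f)
    (hs : s ∈ G.branch f) : (G.label s : G.F) = f :=
  hs.resolve_right fun h => h.1 hf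

/-- The painted stable tree `τ(α)`: the vertex `x` is replaced by an edge which distributes the
flags at `x` between its two ends according to `α`. -/
noncomputable def PSTree.insert {W : Set S} (τ : PSTree W) {x : τ.graph.V}
    (α : VertexPartition τ x) : PSTree W where
  graph := τ.graph.split x α.part
  stable := by
    have := τ.graph.finite_F
    have finF : Finite (τ.graph.split x α.part).F := (τ.graph.split x α.part).finite_F
    have bdA : ∀ g, g ∈ α.part → (τ.graph.split x α.part).bd (Sum.inl g) = none :=
      fun g hg => if_pos hg
    have bdN : ∀ g, g ∉ α.part → (τ.graph.split x α.part).bd (Sum.inl g) = some (τ.graph.bd g) :=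
      fun g hg => if_neg hg
    refine ⟨SGraph.split_isTree τ.stable.tree x α.part α.at_vertex, ?_, ?_⟩
    · rintro (_ | y)
      · obtain ⟨a, ha, b, hb, hab⟩ := α.two_in
        exact three_le (a := (Sum.inl a : τ.graph.F ⊕ Bool)) (b := Sum.inl b) (c := Sum.inr true)
          (bdA a ha) (bdA b hb) rfl (fun h => hab (Sum.inl.inj h)) Sum.inl_ne_inr Sum.inl_ne_inr
      · by_cases hy : y = x
        · subst hy
          obtain ⟨a, ha, b, hb, hab⟩ := α.two_out
          refine three_le (a := (Sum.inl a : τ.graph.F ⊕ Bool)) (b := Sum.inl b)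
            (c := Sum.inr false) ?_ ?_ rfl (fun h => hab (Sum.inl.inj h)) Sum.inl_ne_inr Sum.inl_ne_inr
          · exact (bdN a ha.2).trans (congrArg some ha.1)
          · exact (bdN b hb.2).trans (congrArg some hb.1)
        · obtain ⟨a, ha, b, hb, c, hc, hab, hac, hbc⟩ :=
            (Set.two_lt_ncard (Set.toFinite _)).1 (τ.stable.stable y)
          have key : ∀ g, τ.graph.bd g = y →
              (τ.graph.split x α.part).bd (Sum.inl g) = some y := by
            intro g hg
            rw [bdN g fun h => hy (hg.symm.trans (α.at_vertex g h)), hg]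
          exact three_le (a := (Sum.inl a : τ.graph.F ⊕ Bool)) (b := Sum.inl b) (c := Sum.inl c)
            (key a ha) (key b hb) (key c hc) (fun h => hab (Sum.inl.inj h))
            (fun h => hac (Sum.inl.inj h)) (fun h => hbc (Sum.inl.inj h))
    · rintro (_ | y) hsub
      · obtain ⟨f, hf, s, hs, hsW⟩ := α.white_in
        have ht : τ.graph.inv f = f := by
          by_contra h
          have := hsub (x := (Sum.inl f : τ.graph.F ⊕ Bool))
            ⟨bdA f hf, fun h' => h (Sum.inl.inj h')⟩ (y := Sum.inr true) ⟨rfl, fun h' => absurd (Sum.inr.inj h') (by decide)⟩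
          exact Sum.inl_ne_inr this
        refine ⟨s, hsW, bdA _ ?_⟩
        rw [branch_tail ht hs]; exact hf
      · by_cases hy : y = x
        · subst hy
          obtain ⟨f, hf, hf', s, hs, hsW⟩ := α.white_out
          have ht : τ.graph.inv f = f := by
            by_contra h
            have := hsub (x := (Sum.inl f : τ.graph.F ⊕ Bool))
              ⟨(bdN f hf').trans (congrArg some hf), fun h' => h (Sum.inl.inj h')⟩
              (y := Sum.inr false) ⟨rfl, fun h' => absurd (Sum.inr.inj h') (by decide)⟩
            exact Sum.inl_ne_inr this
          refine ⟨s, hsW, ?_⟩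
          have h1 := branch_tail ht hs
          refine (bdN _ ?_).trans (congrArg some ?_)
          · rw [h1]; exact hf'
          · rw [h1]; exact hf
        · have key : ∀ g, τ.graph.bd g = y →
              (τ.graph.split x α.part).bd (Sum.inl g) = some y := by
            intro g hg
            rw [bdN g fun h => hy (hg.symm.trans (α.at_vertex g h)), hg]
          obtain ⟨s, hsW, hs⟩ := τ.stable.white y (by
            rintro a ⟨ha, ha'⟩ b ⟨hb, hb'⟩
            exact Sum.inl.inj (hsub (x := (Sum.inl a : τ.graph.F ⊕ Bool))
              ⟨key a ha, fun h => ha' (Sum.inl.inj h)⟩ (y := Sum.inl b)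
              ⟨key b hb, fun h => hb' (Sum.inl.inj h)⟩))
          exact ⟨s, hsW, key _ hs⟩

/-- The 2-partition of `S` that corresponds to a 2-partition `α` of the set of flags at `x`:
the partition defined by the new edge of `τ(α)`. -/
noncomputable def PSTree.vertexPartition {W : Set S} (τ : PSTree W) {x : τ.graph.V}
    (α : VertexPartition τ x) : StablePartition W :=
  (τ.insert α).edgePartition
    ((τ.insert α).graph.edgeOf (Sum.inr true : τ.graph.F ⊕ Bool) (by simp [PSTree.insert, split]))

/-- The tree with one vertex. -/
def PSTree.point {W : Set S} [Finite S] (h3 : 3 ≤ Nat.card S) (hW : W.Nonempty) : PSTree W where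
  graph := SGraph.point S
  stable := by
    refine ⟨⟨⟨PUnit.unit⟩, fun _ _ => .refl, fun f hf => absurd rfl hf⟩, fun x => ?_, fun x _ => ?_⟩
    · have : {f : S | (SGraph.point S).bd f = x} = Set.univ := Set.eq_univ_of_forall fun _ => rfl
      exact h3.trans (by rw [← Set.ncard_univ]; exact le_of_eq (congrArg Set.ncard this.symm))
    · obtain ⟨s, hs⟩ := hW
      exact ⟨s, hs, rfl⟩

section Finiteness

variable {W : Set S}

noncomputable instance [Finite S] : Fintype (StablePartition W) :=
  have : Finite {σ : Sym2 (Set S) // ∃ A, σ = s(A, Aᶜ) ∧ StablePart W A ∧ StablePart W Aᶜ} :=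
    Subtype.finite
  @Fintype.ofFinite (StablePartition W) this

noncomputable instance (G : SGraph S) : Fintype G.Edge :=
  have := G.finite_F
  have : Finite {e : Sym2 G.F // ∃ f, G.inv f ≠ f ∧ e = s(f, G.inv f)} := Subtype.finite
  @Fintype.ofFinite G.Edge this

noncomputable instance (τ : PSTree W) (x : τ.graph.V) : Fintype (VertexPartition τ x) :=
  have := τ.graph.finite_F
  have : Finite (VertexPartition τ x) := Finite.of_injective VertexPartition.part (by
    rintro ⟨a, _⟩ ⟨b, _⟩ h; congr)
  Fintype.ofFinite _

end Finiteness

section Isomorphism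

/-- The identity. -/
def SGraph.Iso.refl (G : SGraph S) : G.Iso G :=
  ⟨Equiv.refl _, Equiv.refl _, fun _ => rfl, fun _ => rfl, fun _ => rfl⟩

/-- The inverse isomorphism. -/
def SGraph.Iso.symm {G H : SGraph S} (φ : G.Iso H) : H.Iso G where
  onV := φ.onV.symm
  onF := φ.onF.symm
  bd_eq f := by rw [Equiv.eq_symm_apply, ← φ.bd_eq, Equiv.apply_symm_apply]
  inv_eq f := by rw [Equiv.eq_symm_apply, ← φ.inv_eq, Equiv.apply_symm_apply]
  label_eq s := by rw [Equiv.eq_symm_apply, φ.label_eq]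

/-- The composition. -/
def SGraph.Iso.trans {G H K : SGraph S} (φ : G.Iso H) (ψ : H.Iso K) : G.Iso K where
  onV := φ.onV.trans ψ.onV
  onF := φ.onF.trans ψ.onF
  bd_eq f := by simp [ψ.bd_eq, φ.bd_eq]
  inv_eq f := by simp [ψ.inv_eq, φ.inv_eq]
  label_eq s := by simp [ψ.label_eq, φ.label_eq]

theorem SGraph.Iso.reachOff {G H : SGraph S} (φ : G.Iso H) {f : G.F} {a b : G.V}
    (h : G.ReachOff f a b) : H.ReachOff (φ.onF f) (φ.onV a) (φ.onV b) := by
  induction h with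
  | refl => exact .refl
  | tail _ h ih =>
    obtain ⟨g, h1, h2, rfl, rfl⟩ := h
    refine ih.tail ⟨φ.onF g, fun h => h1 (φ.onF.injective h), fun h => h2 (φ.onF.injective ?_),
      φ.bd_eq g, ?_⟩
    · rw [h, φ.inv_eq]
    · rw [φ.inv_eq, φ.bd_eq]

theorem SGraph.Iso.branch_subset {G H : SGraph S} (φ : G.Iso H) (f : G.F) :
    G.branch f ⊆ H.branch (φ.onF f) := by
  rintro s (h | ⟨h1, h2⟩)
  · exact Or.inl (by rw [φ.label_eq, h])
  · refine Or.inr ⟨fun h => h1 (φ.onF.injective (by rw [← φ.inv_eq, h])), ?_⟩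
    rw [φ.inv_eq, φ.bd_eq, φ.label_eq, φ.bd_eq]
    exact φ.reachOff h2

theorem SGraph.Iso.branch_eq {G H : SGraph S} (φ : G.Iso H) (f : G.F) :
    H.branch (φ.onF f) = G.branch f := by
  refine Set.Subset.antisymm ?_ (φ.branch_subset f)
  have := φ.symm.branch_subset (φ.onF f)
  rwa [show φ.symm.onF (φ.onF f) = f from φ.onF.symm_apply_apply f] at this

/-- The induced map of the edges. -/
def SGraph.Iso.mapEdge {G H : SGraph S} (φ : G.Iso H) (e : G.Edge) : H.Edge :=
  ⟨e.1.map φ.onF, by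
    obtain ⟨_, f, hf, rfl⟩ := e
    refine ⟨φ.onF f, fun h => hf (φ.onF.injective (by rw [← φ.inv_eq, h])), ?_⟩
    rw [φ.inv_eq]; rfl⟩

/-- The induced bijection of the edges. -/
def SGraph.Iso.onEdge {G H : SGraph S} (φ : G.Iso H) : G.Edge ≃ H.Edge where
  toFun := φ.mapEdge
  invFun := φ.symm.mapEdge
  left_inv := by
    rintro ⟨e, he⟩
    refine Subtype.ext ?_
    induction e with
    | _ a b => simp [mapEdge, Iso.symm]
  right_inv := by
    rintro ⟨e, he⟩
    refine Subtype.ext ?_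
    induction e with
    | _ a b => simp [mapEdge, Iso.symm]

theorem PSTree.edgePartition_onEdge {W : Set S} {τ τ' : PSTree W} (φ : τ.graph.Iso τ'.graph)
    (e : τ.graph.Edge) : τ'.edgePartition (φ.onEdge e) = τ.edgePartition e := by
  obtain ⟨e, he⟩ := e
  refine Subtype.ext ?_
  induction e with
  | _ a b => simp [edgePartition, Iso.onEdge, Iso.mapEdge, φ.branch_eq]

/-- Two painted stable `S`-trees are equivalent if they are `S`-isomorphic. -/
def treeSetoid (W : Set S) : Setoid (PSTree W) where
  r τ τ' := Nonempty (τ.graph.Iso τ'.graph)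
  iseqv := ⟨fun τ => ⟨.refl _⟩, fun ⟨φ⟩ => ⟨φ.symm⟩, fun ⟨φ⟩ ⟨ψ⟩ => ⟨φ.trans ψ⟩⟩

/-- The `S`-isomorphism classes of painted stable `S`-trees. -/
def TreeClass (W : Set S) := Quotient (treeSetoid W)

end Isomorphism

section Cohomology

variable (k : Type v) [CommRing k] (W : Set S)

/-- The polynomial ring on independent variables indexed by painted stable 2-partitions. -/
abbrev PolyRing := MvPolynomial (StablePartition W) k

/-- The variable `l_σ`. -/
noncomputable abbrev gen {W : Set S} (σ : StablePartition W) : PolyRing k W := MvPolynomial.X σ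

open Classical in
/-- The sign `ε(σ; i, j, k, l)`. -/
noncomputable def sign {W : Set S} (σ : StablePartition W) (a b c d : S) : k :=
  if Allowed W a b c d ∧ σ.Separates a b c d then 1
  else if Allowed W a b c d ∧ σ.Separates c b a d then -1
  else 0

/-- The linear generators `R_{ijkl}`. -/
noncomputable def linRel [Finite S] (a b c d : S) : PolyRing k W :=
  ∑ σ : StablePartition W, MvPolynomial.C (sign k σ a b c d) * gen k σ

/-- The ideal generated by all `R_{ijkl}` and by the products `l_σ l_σ'` such that for some
allowed quadruple one has `ij σ kl` and `kj σ' il`. -/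
noncomputable def relIdeal [Finite S] : Ideal (PolyRing k W) :=
  Ideal.span
    ({p | ∃ a b c d : S, p = linRel k W a b c d} ∪
      {p | ∃ (σ σ' : StablePartition W) (a b c d : S), Allowed W a b c d ∧
        σ.Separates a b c d ∧ σ'.Separates c b a d ∧ p = gen k σ * gen k σ'})

/-- The combinatorial cohomology ring. -/
abbrev Cohomology [Finite S] := PolyRing k W ⧸ relIdeal k W

/-- The good monomial of a tree. -/
noncomputable def PSTree.monomial {W : Set S} (τ : PSTree W) : PolyRing k W :=
  ∏ e : τ.graph.Edge, gen k (τ.edgePartition e)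

/-- The good monomial of an isomorphism class of trees. -/
noncomputable def goodMonomial {W : Set S} : TreeClass W → PolyRing k W :=
  Quotient.lift (PSTree.monomial k) (by
    rintro τ τ' ⟨φ⟩
    exact Fintype.prod_equiv φ.onEdge _ _ fun e => by rw [PSTree.edgePartition_onEdge])

end Cohomology

section Homology

variable (k : Type v) [CommRing k]

/-- The free module on the isomorphism classes of painted stable trees. -/
abbrev FreeTrees (W : Set S) := TreeClass W →₀ k

/-- The generator `μ(τ)`. -/
noncomputable def mu {W : Set S} (τ : PSTree W) : FreeTrees k W :=
  Finsupp.single (Quotient.mk (treeSetoid W) τ) 1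

/-- Allowed quadruples of flags: on the four branches there are labels forming an allowed
quadruple. -/
def AllowedFlags {W : Set S} (τ : PSTree W) (I J K L : τ.graph.F) : Prop :=
  ∃ a ∈ τ.graph.branch I, ∃ b ∈ τ.graph.branch J, ∃ c ∈ τ.graph.branch K,
    ∃ d ∈ τ.graph.branch L, Allowed W a b c d

open Classical in
/-- The sum of `μ(τ(α))` over all painted stable 2-partitions `α` of the set of flags at `x` with
`IJ α KL`; each of these is counted once, through its part that contains `I` and `J`. -/
noncomputable def cutSum {W : Set S} (τ : PSTree W) (x : τ.graph.V) (I J K L : τ.graph.F) :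
    FreeTrees k W :=
  ∑ α : VertexPartition τ x, if α.Separates I J K L then mu k (τ.insert α) else 0

/-- The submodule spanned by the standard relations `∑_α ε(α; I, J, K, L) μ(τ(α))`, one for each
tree `τ`, vertex `x` and allowed quadruple of pairwise distinct flags at `x`. -/
noncomputable def standardRelations (W : Set S) : Submodule k (FreeTrees k W) :=
  Submodule.span k {r | ∃ (τ : PSTree W) (x : τ.graph.V) (I J K L : τ.graph.F),
    (∀ f ∈ [I, J, K, L], τ.graph.bd f = x) ∧ [I, J, K, L].Nodup ∧ AllowedFlags τ I J K L ∧
    r = cutSum k τ x I J K L - cutSum k τ x K J I L}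

/-- The combinatorial homology module. -/
abbrev Homology (W : Set S) := FreeTrees k W ⧸ standardRelations k W

/-- The class `[μ(τ)]`. -/
noncomputable def muClass {W : Set S} (τ : PSTree W) : Homology k W :=
  (standardRelations k W).mkQ (mu k τ)

/-- The class of a linear combination of trees. -/
noncomputable abbrev toHomology (W : Set S) : FreeTrees k W →ₗ[k] Homology k W :=
  (standardRelations k W).mkQ

/-- The class of `l_σ`. -/
noncomputable def lClass [Finite S] {W : Set S} (σ : StablePartition W) : Cohomology k W :=
  Ideal.Quotient.mk (relIdeal k W) (gen k σ)

/-- The three formulas for the action of `l_σ` on the classes `[μ(τ)]`; the formula for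
`σ` breaking `τ` at an edge `{e₁, e₂}` is required for every allowed choice of flags. -/
structure IsTreeAction [Finite S] {W : Set S}
    (ρ : Cohomology k W →ₐ[k] Module.End k (Homology k W)) : Prop where
  /-- `σ` does not break `τ`. -/
  not_break : ∀ (σ : StablePartition W) (τ : PSTree W),
    (∀ e, τ.edgePartition e ≠ σ) →
    (∀ (x : τ.graph.V) (α : VertexPartition τ x), τ.vertexPartition α ≠ σ) →
    ρ (lClass k σ) (muClass k τ) = 0
  /-- `σ` breaks `τ` at the vertex `x`. -/
  break_vertex : ∀ (σ : StablePartition W) (τ : PSTree W) (x : τ.graph.V)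
    (α : VertexPartition τ x), τ.vertexPartition α = σ →
    ρ (lClass k σ) (muClass k τ) = muClass k (τ.insert α)
  /-- `σ` breaks `τ` at an edge with halves `e₁` and `e₂ = inv e₁`. -/
  break_edge : ∀ (σ : StablePartition W) (τ : PSTree W) (e₁ : τ.graph.F)
    (he : τ.graph.inv e₁ ≠ e₁), τ.edgePartition (τ.graph.edgeOf e₁ he) = σ →
    ∀ I J K L : τ.graph.F,
    (∀ f ∈ [I, J], τ.graph.bd f = τ.graph.bd e₁) → [I, J, e₁].Nodup →
    (∀ f ∈ [K, L], τ.graph.bd f = τ.graph.bd (τ.graph.inv e₁)) →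
    [K, L, τ.graph.inv e₁].Nodup → AllowedFlags τ I J K L →
    ρ (lClass k σ) (muClass k τ) =
      toHomology k W (- cutSum k τ (τ.graph.bd e₁) I J e₁ e₁
        - cutSum k τ (τ.graph.bd (τ.graph.inv e₁)) K L (τ.graph.inv e₁) (τ.graph.inv e₁))

end Homology

end PaintedTrees

/-!
The theorem is an instance of a statement about simplicial complexes. Let `Δ` be a complex on a
finite vertex set `V` and `Λ` a module of functions `V → k` such that every vertex `v` of every
face `F` has a dual form: `m ∈ Λ` with `m v = 1` and `m = 0` on the rest of `F`. In the quotient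
`A` of the polynomial ring `k[x_v]` by the linear forms `∑ m v x_v`, `m ∈ Λ`, and by the products
over non-faces, the square-free monomials of the faces span (a repeated variable is traded
for others by a dual form, `mul_prod_of_mem`, `span_prod_faces`), and all linear relations between
them follow from the relations `∑_{w ∉ F} m w x_{F ∪ w} = 0` where `F` is a face and `m ∈ Λ`
vanishes on `F`. For the latter, let `N` be the module generated by the faces with these relations
(`FaceModule`). The variables act on `N`: `x_v F = F ∪ v` if `v ∉ F`, and
`x_v F = -∑_{w ∉ F} m w (F ∪ w)` if `v ∈ F` and `m` is dual to `v`. That this is well defined and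
that the operators commute follows formally from two facts: `∑_w m w x_w F = 0` for all `m ∈ Λ`
(`sum_varMul`), and the symmetry `x_v (F ∪ w) = x_w (F ∪ v)` for `v, w ∉ F`
(`varMul_insert_comm`). Acting on the empty face gives a linear map `A → N` that takes the
monomial of a face to the class of this face (`exists_faceClass_map`).

Here `V` is the set of the stable 2-partitions of `S`, the faces are the sets of pairwise
non-crossing partitions, and `Λ` is spanned by the forms `σ ↦ ε(σ; i, j, k, l)`. Two things
have to be supplied.

The faces are the isomorphism classes of painted stable trees. A tree is mapped to the
set of the partitions `σ_e`; it can be recovered from this set because each flag is determined by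
its branch and because the branches tell which flags share a vertex (`PSTree.bd_eq_iff`,
`PSTree.nonempty_iso`). A partition that crosses no edge and is not itself defined by
an edge has the form `σ_α` for a partition `α` of the flags at some vertex
(`PSTree.exists_breaksAt`, `PSTree.exists_vertexPartition`), so every face comes from a tree by
inserting edges one at a time. A dual form for an edge is given by labels `i, j` and `k, l` on
branches at its two ends (`PSTree.AroundEdge`).

The relations of the module `N` are consequences of the standard ones
(`PSTree.sum_smul_eq_zero`). Fix a white label `r`, and for a pair of labels `i, j` let `D_ij` be
the indicator function of the partitions that separate `i, j` from `r`. Then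
`ε(· ; i, j, k, l) = D_ij + D_kl - D_kj - D_il`, so each `m ∈ Λ` is a combination, with
coefficients of sum zero, of forms `D_ij` where `i` is white. Each triple `i, j, r` has a median
vertex in a tree `τ`. If `m` vanishes on all edges of `τ`, then the coefficients of the pairs
with a given median vertex have sum zero, by induction from the leaves to the root `r`; and
modulo the standard relations at that vertex `D_ij` depends only on the median vertex.

It follows that `μ(τ) ↦ m(τ)` induces an isomorphism of `H_{*S}` with `H^*_S` as modules over `k`
(`exists_homologyEquiv`), and the required action is multiplication in `H^*_S` transported by it.
The formulas for the action are then identities between products in `H^*_S`, and they determine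
the action because every edge admits an allowed choice of flags.
-/

namespace PaintedTrees

/-! ### Faces of a simplicial complex with dual linear forms -/

open scoped IsMulCommutative in
/-- A family of commuting endomorphisms makes a module over the polynomial ring. -/
theorem exists_algHom_of_commute {k : Type v} [CommRing k] {V N : Type*} [AddCommGroup N]
    [Module k N] (X : V → Module.End k N) (hX : ∀ v w, Commute (X v) (X w)) :
    ∃ φ : MvPolynomial V k →ₐ[k] Module.End k N, ∀ v, φ (MvPolynomial.X v) = X v := by
  have : IsMulCommutative (Algebra.adjoin k (Set.range X)) :=
    Algebra.isMulCommutative_adjoin k (by rintro _ ⟨v, rfl⟩ _ ⟨w, rfl⟩; exact hX v w)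
  refine ⟨(Algebra.adjoin k (Set.range X)).val.comp (MvPolynomial.aeval fun v =>
    (⟨X v, Algebra.subset_adjoin ⟨v, rfl⟩⟩ : Algebra.adjoin k (Set.range X))), fun v => ?_⟩
  simp

section Unimodular

variable {k : Type v} [CommRing k] {V : Type*} [Fintype V] [DecidableEq V]

/-- The relations between face classes: non-faces vanish, and for each set `F` and each form of `Λ`
that vanishes on `F` the combination of the sets `F ∪ w` with the values of this form as
coefficients vanishes. Working with all finite sets, and killing the non-faces, spares the
conditions that the sets `F ∪ w` be faces. -/
noncomputable def faceRelations (Δ : Finset V → Prop) (Λ : Submodule k (V → k)) :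
    Submodule k (Finset V →₀ k) :=
  Submodule.span k ({r | ∃ F, ¬ Δ F ∧ r = Finsupp.single F 1} ∪
    {r | ∃ F, ∃ m ∈ Λ, (∀ w ∈ F, m w = 0) ∧
      r = ∑ w ∈ Fᶜ, m w • Finsupp.single (insert w F) (1 : k)})

/-- The module of face classes. -/
abbrev FaceModule (Δ : Finset V → Prop) (Λ : Submodule k (V → k)) :=
  (Finset V →₀ k) ⧸ faceRelations Δ Λ

/-- Every vertex of a face has a dual linear form among the forms of `Λ`. -/
def HasDuals (Δ : Finset V → Prop) (Λ : Submodule k (V → k)) : Prop :=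
  ∀ F, Δ F → ∀ v ∈ F, ∃ m ∈ Λ, m v = 1 ∧ ∀ w ∈ F, w ≠ v → m w = 0

variable (Δ : Finset V → Prop) (Λ : Submodule k (V → k))

/-- The class of a face. -/
noncomputable def faceClass (F : Finset V) : FaceModule Δ Λ :=
  (faceRelations Δ Λ).mkQ (Finsupp.single F 1)

variable {Δ Λ}

theorem faceClass_eq_zero {F : Finset V} (hF : ¬ Δ F) : faceClass Δ Λ F = 0 :=
  (Submodule.Quotient.mk_eq_zero _).2 (Submodule.subset_span (Or.inl ⟨F, hF, rfl⟩))

theorem faceClass_relation {F : Finset V} {m : V → k} (hm : m ∈ Λ) (h0 : ∀ w ∈ F, m w = 0) :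
    ∑ w ∈ Fᶜ, m w • faceClass Δ Λ (insert w F) = 0 := by
  have : (faceRelations Δ Λ).mkQ (∑ w ∈ Fᶜ, m w • Finsupp.single (insert w F) (1 : k)) = 0 :=
    (Submodule.Quotient.mk_eq_zero _).2 (Submodule.subset_span (Or.inr ⟨F, m, hm, h0, rfl⟩))
  simpa only [map_sum, map_smul, faceClass] using this

open Classical in
variable (Δ Λ) in
/-- The product of a variable with a face class. If `v ∈ F`, a form dual to `v` is chosen; the
result does not depend on it by `varMul_of_mem`. -/
noncomputable def varMul (v : V) (F : Finset V) : FaceModule Δ Λ :=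
  if v ∉ F then faceClass Δ Λ (insert v F)
  else if h : ∃ m ∈ Λ, m v = 1 ∧ ∀ w ∈ F, w ≠ v → m w = 0 then
    - ∑ w ∈ Fᶜ, h.choose w • faceClass Δ Λ (insert w F)
  else 0

theorem varMul_of_notMem {v : V} {F : Finset V} (h : v ∉ F) :
    varMul Δ Λ v F = faceClass Δ Λ (insert v F) := if_pos h

theorem varMul_of_mem {v : V} {F : Finset V} (h : v ∈ F) {m : V → k} (hm : m ∈ Λ)
    (h1 : m v = 1) (h0 : ∀ w ∈ F, w ≠ v → m w = 0) :
    varMul Δ Λ v F = - ∑ w ∈ Fᶜ, m w • faceClass Δ Λ (insert w F) := by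
  have hex : ∃ m ∈ Λ, m v = 1 ∧ ∀ w ∈ F, w ≠ v → m w = 0 := ⟨m, hm, h1, h0⟩
  rw [varMul, if_neg (not_not.2 h), dif_pos hex, neg_inj, ← sub_eq_zero, ← Finset.sum_sub_distrib]
  obtain ⟨hm', h1', h0'⟩ := hex.choose_spec
  simp_rw [← sub_smul]
  refine faceClass_relation (m := hex.choose - m) (Λ.sub_mem hm' hm) fun w hw => ?_
  by_cases hwv : w = v
  · subst hwv; simp [h1, h1']
  · simp [h0 w hw hwv, h0' w hw hwv]

theorem varMul_nonface (hΔ : ∀ F G, F ⊆ G → Δ G → Δ F) (v : V) {F : Finset V} (hF : ¬ Δ F) :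
    varMul Δ Λ v F = 0 := by
  have key : ∀ w, faceClass Δ Λ (insert w F) = 0 := fun w =>
    faceClass_eq_zero fun h => hF (hΔ _ _ (Finset.subset_insert _ _) h)
  unfold varMul
  split_ifs <;> simp [key]

theorem varMul_insert_comm {v w : V} {F : Finset V} (hv : v ∉ F) (hw : w ∉ F) :
    varMul Δ Λ v (insert w F) = varMul Δ Λ w (insert v F) := by
  by_cases h : v = w
  · rw [h]
  rw [varMul_of_notMem (by simp [h, hv]), varMul_of_notMem (by simp [Ne.symm h, hw]),
    Finset.insert_comm]

/-- The linear forms of `Λ` act by zero: a form is the sum of a combination of dual forms, whose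
contributions cancel by the definition of the product, and of a form that vanishes on `F`. -/
theorem sum_varMul (hΔ : ∀ F G, F ⊆ G → Δ G → Δ F) (hU : HasDuals Δ Λ) {m : V → k} (hm : m ∈ Λ)
    (F : Finset V) : ∑ w, m w • varMul Δ Λ w F = 0 := by
  by_cases hF : Δ F
  swap
  · exact Finset.sum_eq_zero fun w _ => by rw [varMul_nonface hΔ w hF, smul_zero]
  choose! d hd h1 h0 using hU F hF
  have hrel := faceClass_relation (Δ := Δ) (F := F) (m := m - ∑ v ∈ F, m v • d v)
    (Λ.sub_mem hm (Λ.sum_mem fun v hv => Λ.smul_mem _ (hd v hv))) (by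
      intro w hw
      simp only [Pi.sub_apply, Finset.sum_apply, Pi.smul_apply, smul_eq_mul]
      rw [Finset.sum_eq_single w (fun v hv hvw => by rw [h0 v hv w hw (Ne.symm hvw), mul_zero])
        (fun h => absurd hw h), h1 w hw, mul_one, sub_self])
  rw [← Finset.sum_add_sum_compl F]
  have e1 : ∑ v ∈ F, m v • varMul Δ Λ v F =
      - ∑ w ∈ Fᶜ, (∑ v ∈ F, m v • d v) w • faceClass Δ Λ (insert w F) := by
    rw [Finset.sum_congr rfl fun v hv => by
      rw [varMul_of_mem hv (hd v hv) (h1 v hv) (h0 v hv), smul_neg, Finset.smul_sum],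
      Finset.sum_neg_distrib, Finset.sum_comm]
    simp only [Finset.sum_apply, Pi.smul_apply, smul_eq_mul, Finset.sum_smul, mul_smul]
  have e2 : ∑ v ∈ Fᶜ, m v • varMul Δ Λ v F = ∑ w ∈ Fᶜ, m w • faceClass Δ Λ (insert w F) :=
    Finset.sum_congr rfl fun v hv => by rw [varMul_of_notMem (Finset.mem_compl.1 hv)]
  rw [e1, e2, neg_add_eq_sub, ← Finset.sum_sub_distrib]
  simp_rw [← sub_smul]
  exact hrel

theorem sum_compl_varMul (hΔ : ∀ F G, F ⊆ G → Δ G → Δ F) (hU : HasDuals Δ Λ) {m : V → k}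
    (hm : m ∈ Λ) {F : Finset V} (h0 : ∀ w ∈ F, m w = 0) (G : Finset V) :
    ∑ w ∈ Fᶜ, m w • varMul Δ Λ w G = 0 := by
  rw [← sum_varMul hΔ hU hm G, ← Finset.sum_add_sum_compl F,
    Finset.sum_eq_zero (s := F) fun w hw => by rw [h0 w hw, zero_smul], zero_add]

theorem varMul_insert_of_mem (hΔ : ∀ F G, F ⊆ G → Δ G → Δ F) (hU : HasDuals Δ Λ) {v : V}
    {F : Finset V} (hv : v ∈ F) {m : V → k} (hm : m ∈ Λ) (h1 : m v = 1)
    (h0 : ∀ w ∈ F, w ≠ v → m w = 0) (w : V) :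
    varMul Δ Λ v (insert w F) = - ∑ z ∈ Fᶜ, m z • varMul Δ Λ z (insert w F) := by
  have h := sum_varMul hΔ hU hm (insert w F)
  rw [← Finset.sum_add_sum_compl F, Finset.sum_eq_single_of_mem v hv
    (fun z hz hzv => by rw [h0 z hz hzv, zero_smul]), h1, one_smul] at h
  exact eq_neg_of_add_eq_zero_left h

variable (Δ Λ) in
/-- The action of a variable on the free module on finite sets. -/
noncomputable def varMulLift (v : V) : (Finset V →₀ k) →ₗ[k] FaceModule Δ Λ :=
  Finsupp.linearCombination k (varMul Δ Λ v)

theorem varMulLift_single (v : V) (F : Finset V) :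
    varMulLift Δ Λ v (Finsupp.single F 1) = varMul Δ Λ v F := by
  simp [varMulLift]

theorem faceRelations_le_ker (hΔ : ∀ F G, F ⊆ G → Δ G → Δ F) (hU : HasDuals Δ Λ) (v : V) :
    faceRelations Δ Λ ≤ LinearMap.ker (varMulLift Δ Λ v) := by
  refine Submodule.span_le.2 ?_
  rintro _ (⟨F, hF, rfl⟩ | ⟨F, m, hm, h0, rfl⟩)
  · simp [varMulLift_single, varMul_nonface hΔ v hF]
  simp only [SetLike.mem_coe, LinearMap.mem_ker, map_sum, map_smul, varMulLift_single]
  by_cases hv : v ∈ F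
  · by_cases hF : Δ F
    · obtain ⟨d, hd, hd1, hd0⟩ := hU F hF v hv
      simp_rw [varMul_insert_of_mem hΔ hU hv hd hd1 hd0, smul_neg, Finset.smul_sum]
      rw [Finset.sum_neg_distrib, neg_eq_zero, Finset.sum_comm]
      refine Finset.sum_eq_zero fun z hz => ?_
      rw [← smul_zero (d z), ← sum_compl_varMul hΔ hU hm h0 (insert z F), Finset.smul_sum]
      refine Finset.sum_congr rfl fun w hw => ?_
      rw [varMul_insert_comm (Finset.mem_compl.1 hz) (Finset.mem_compl.1 hw), smul_comm]
    · refine Finset.sum_eq_zero fun w _ => ?_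
      rw [varMul_nonface hΔ v fun h => hF (hΔ _ _ (Finset.subset_insert _ _) h), smul_zero]
  · rw [← sum_compl_varMul hΔ hU hm h0 (insert v F)]
    refine Finset.sum_congr rfl fun w hw => ?_
    rw [varMul_insert_comm hv (Finset.mem_compl.1 hw)]

/-- The endomorphism by which a variable acts on the module of face classes. -/
noncomputable def varEnd (hΔ : ∀ F G, F ⊆ G → Δ G → Δ F) (hU : HasDuals Δ Λ) (v : V) :
    Module.End k (FaceModule Δ Λ) :=
  (faceRelations Δ Λ).liftQ (varMulLift Δ Λ v) (faceRelations_le_ker hΔ hU v)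

theorem varEnd_faceClass (hΔ : ∀ F G, F ⊆ G → Δ G → Δ F) (hU : HasDuals Δ Λ) (v : V)
    (F : Finset V) : varEnd hΔ hU v (faceClass Δ Λ F) = varMul Δ Λ v F := by
  simp [varEnd, faceClass, varMulLift_single]

theorem faceModule_hom_ext {N : Type*} [AddCommGroup N] [Module k N]
    {f g : FaceModule Δ Λ →ₗ[k] N} (h : ∀ F, f (faceClass Δ Λ F) = g (faceClass Δ Λ F)) :
    f = g := by
  refine Submodule.linearMap_qext _ (Finsupp.lhom_ext' fun F => LinearMap.ext_ring ?_)
  exact h F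

theorem varEnd_comm (hΔ : ∀ F G, F ⊆ G → Δ G → Δ F) (hU : HasDuals Δ Λ) (v w : V) :
    Commute (varEnd hΔ hU v) (varEnd hΔ hU w) := by
  -- the case where one of the two variables does not occur in the face
  have main : ∀ (v w : V) (F : Finset V), w ∉ F → varEnd hΔ hU v (varMul Δ Λ w F) =
      varEnd hΔ hU w (varMul Δ Λ v F) := by
    intro v w F hw
    rw [varMul_of_notMem hw, varEnd_faceClass]
    by_cases hv : v ∈ F
    · by_cases hF : Δ F
      · obtain ⟨d, hd, hd1, hd0⟩ := hU F hF v hv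
        rw [varMul_insert_of_mem hΔ hU hv hd hd1 hd0, varMul_of_mem hv hd hd1 hd0]
        simp only [map_neg, map_sum, map_smul, varEnd_faceClass]
        congr 1
        exact Finset.sum_congr rfl fun z hz => by
          rw [varMul_insert_comm (Finset.mem_compl.1 hz) hw]
      · rw [varMul_nonface hΔ v hF, map_zero,
          varMul_nonface hΔ v fun h => hF (hΔ _ _ (Finset.subset_insert _ _) h)]
    · rw [varMul_of_notMem hv, varEnd_faceClass, varMul_insert_comm hv hw]
  refine faceModule_hom_ext fun F => ?_
  simp only [Module.End.mul_apply, varEnd_faceClass]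
  by_cases hw : w ∈ F
  swap
  · exact main v w F hw
  by_cases hv : v ∈ F
  swap
  · exact (main w v F hv).symm
  by_cases hF : Δ F
  swap
  · simp [varMul_nonface hΔ _ hF]
  obtain ⟨d, hd, hd1, hd0⟩ := hU F hF v hv
  obtain ⟨c, hc, hc1, hc0⟩ := hU F hF w hw
  rw [varMul_of_mem hv hd hd1 hd0, varMul_of_mem hw hc hc1 hc0]
  simp only [map_neg, map_sum, map_smul, varEnd_faceClass]
  simp_rw [varMul_insert_of_mem hΔ hU hv hd hd1 hd0, varMul_insert_of_mem hΔ hU hw hc hc1 hc0,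
    smul_neg, Finset.smul_sum]
  rw [Finset.sum_neg_distrib, Finset.sum_neg_distrib, Finset.sum_comm]
  congr 2
  refine Finset.sum_congr rfl fun z hz => Finset.sum_congr rfl fun y hy => ?_
  rw [smul_comm, varMul_insert_comm (Finset.mem_compl.1 hz) (Finset.mem_compl.1 hy)]

/-- A linear map from the polynomial ring that vanishes on the ideal of relations and takes the
square-free monomial of each set to its class: a polynomial is mapped to the result of its action
on the class of the empty set. -/
theorem exists_faceClass_map (hΔ : ∀ F G, F ⊆ G → Δ G → Δ F) (hU : HasDuals Δ Λ)
    (I : Ideal (MvPolynomial V k)) (g : Set (MvPolynomial V k)) (hI : I = Ideal.span g)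
    (hg : ∀ p ∈ g, (∃ m ∈ Λ, p = ∑ v, MvPolynomial.C (m v) * MvPolynomial.X v) ∨
      ∃ v w, v ≠ w ∧ ¬ Δ {v, w} ∧ p = MvPolynomial.X v * MvPolynomial.X w) :
    ∃ Ψ : MvPolynomial V k →ₗ[k] FaceModule Δ Λ, (∀ p ∈ I, Ψ p = 0) ∧
      ∀ F : Finset V, Ψ (∏ v ∈ F, MvPolynomial.X v) = faceClass Δ Λ F := by
  obtain ⟨φ, hφ⟩ := exists_algHom_of_commute (varEnd hΔ hU) (varEnd_comm hΔ hU)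
  refine ⟨(LinearMap.applyₗ (faceClass Δ Λ ∅)).comp φ.toLinearMap, ?_, ?_⟩
  · subst hI
    intro p hp
    induction hp using Submodule.span_induction with
    | mem p hp =>
      rcases hg p hp with ⟨m, hm, rfl⟩ | ⟨v, w, hvw, hn, rfl⟩
      · rw [← sum_varMul hΔ hU hm ∅]
        simp [← MvPolynomial.algebraMap_eq, hφ, varEnd_faceClass, Algebra.algebraMap_eq_smul_one]
      · have : varEnd hΔ hU v (varEnd hΔ hU w (faceClass Δ Λ ∅)) = faceClass Δ Λ {v, w} := by
          rw [varEnd_faceClass, varMul_of_notMem (by simp), varEnd_faceClass,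
            varMul_of_notMem (by simpa using hvw)]
          simp
        simp [hφ, this, faceClass_eq_zero hn]
    | zero => simp
    | add p q _ _ hp hq => rw [map_add, hp, hq, add_zero]
    | smul a p _ hp =>
      simp only [LinearMap.comp_apply, LinearMap.applyₗ_apply_apply, AlgHom.toLinearMap_apply,
        smul_eq_mul, map_mul, Module.End.mul_apply] at hp ⊢
      rw [hp, map_zero]
  · intro F
    induction F using Finset.induction_on with
    | empty => simp
    | insert v F hv ih =>
      rw [Finset.prod_insert hv]
      simp only [LinearMap.comp_apply, LinearMap.applyₗ_apply_apply, AlgHom.toLinearMap_apply,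
        map_mul, Module.End.mul_apply, hφ] at ih ⊢
      rw [ih, varEnd_faceClass, varMul_of_notMem hv]

section SquareFree

variable {A : Type*} [CommRing A] [Algebra k A] {x : V → A}

theorem sum_smul_prod_insert {m : V → k} (hm : ∑ v, m v • x v = 0) {F : Finset V}
    (h0 : ∀ w ∈ F, m w = 0) : ∑ w ∈ Fᶜ, m w • ∏ u ∈ insert w F, x u = 0 := by
  have h : (∑ v, m v • x v) * ∏ u ∈ F, x u = 0 := by rw [hm, zero_mul]
  rw [← Finset.sum_add_sum_compl F,
    Finset.sum_eq_zero (s := F) fun w hw => by rw [h0 w hw, zero_smul], zero_add,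
    Finset.sum_mul] at h
  rw [← h]
  exact Finset.sum_congr rfl fun w hw => by
    rw [Finset.prod_insert (Finset.mem_compl.1 hw), smul_mul_assoc]

theorem mul_prod_of_mem {m : V → k} (hm : ∑ v, m v • x v = 0) {F : Finset V} {v : V} (hv : v ∈ F)
    (h1 : m v = 1) (h0 : ∀ w ∈ F, w ≠ v → m w = 0) :
    x v * ∏ u ∈ F, x u = - ∑ w ∈ Fᶜ, m w • ∏ u ∈ insert w F, x u := by
  have h : (∑ v, m v • x v) * ∏ u ∈ F, x u = 0 := by rw [hm, zero_mul]
  rw [← Finset.sum_add_sum_compl F, Finset.sum_eq_single_of_mem v hv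
    (fun z hz hzv => by rw [h0 z hz hzv, zero_smul]), h1, one_smul, add_mul, Finset.sum_mul] at h
  rw [eq_neg_of_add_eq_zero_left h]
  congr 1
  exact Finset.sum_congr rfl fun w hw => by
    rw [Finset.prod_insert (Finset.mem_compl.1 hw), smul_mul_assoc]

/-- Square-free monomials of faces span: a repeated variable is eliminated by a dual form. -/
theorem span_prod_faces (hU : HasDuals Δ Λ)
    (hΛ : ∀ m ∈ Λ, ∑ v, m v • x v = 0) (hn : ∀ F : Finset V, ¬ Δ F → ∏ v ∈ F, x v = 0)
    (hx : Algebra.adjoin k (Set.range x) = ⊤) :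
    Submodule.span k {a | ∃ F, Δ F ∧ a = ∏ v ∈ F, x v} = ⊤ := by
  set P := Submodule.span k {a | ∃ F, Δ F ∧ a = ∏ v ∈ F, x v} with hP
  have mem : ∀ F : Finset V, ∏ v ∈ F, x v ∈ P := by
    intro F
    by_cases hF : Δ F
    · exact Submodule.subset_span ⟨F, hF, rfl⟩
    · rw [hn F hF]; exact P.zero_mem
  have mul : ∀ v, ∀ a ∈ P, x v * a ∈ P := by
    intro v a ha
    induction ha using Submodule.span_induction with
    | mem a h =>
      obtain ⟨F, hF, rfl⟩ := h
      by_cases hv : v ∈ F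
      · obtain ⟨m, hm, h1, h0⟩ := hU F hF v hv
        rw [mul_prod_of_mem (hΛ m hm) hv h1 h0]
        exact P.neg_mem (P.sum_mem fun w _ => P.smul_mem _ (mem _))
      · rw [← Finset.prod_insert hv]; exact mem _
    | zero => rw [mul_zero]; exact P.zero_mem
    | add a b _ _ ha hb => rw [mul_add]; exact P.add_mem ha hb
    | smul c a _ ha => rw [mul_smul_comm]; exact P.smul_mem _ ha
  rw [eq_top_iff]
  rintro a -
  have ha : a ∈ Algebra.adjoin k (Set.range x) := hx ▸ Algebra.mem_top
  suffices H : ∀ b ∈ P, a * b ∈ P by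
    have := H 1 (by simpa using mem ∅)
    rwa [mul_one] at this
  induction ha using Algebra.adjoin_induction with
  | mem a h => obtain ⟨v, rfl⟩ := h; exact mul v
  | algebraMap c => intro b hb; rw [← Algebra.smul_def]; exact P.smul_mem _ hb
  | add a b _ _ ha hb =>
    intro c hc; rw [add_mul]; exact P.add_mem (ha c hc) (hb c hc)
  | mul a b _ _ ha hb =>
    intro c hc; rw [mul_assoc]; exact ha _ (hb c hc)

end SquareFree

end Unimodular

/-! ### Branches of a tree -/

namespace SGraph

variable {S : Type u} {G : SGraph S}

/-- Every vertex `y ≠ x` lies beyond some flag at `x`. -/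
theorem IsTree.exists_toward (hG : G.IsTree) (x y : G.V) :
    y = x ∨ ∃ f, G.bd f = x ∧ G.inv f ≠ f ∧ G.ReachOff f (G.bd (G.inv f)) y := by
  induction hG.connected x y with
  | refl => exact Or.inl rfl
  | @tail y z _ h ih =>
    obtain ⟨g, rfl, rfl⟩ := h
    by_cases hg : G.inv g = g
    · rw [hg]; exact ih
    rcases ih with h | ⟨f, hf, hf', hy⟩
    · exact Or.inr ⟨g, h, hg, .refl⟩
    by_cases h1 : g = f
    · subst h1; exact Or.inr ⟨g, hf, hg, .refl⟩
    by_cases h2 : g = G.inv f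
    · left; rw [h2, G.inv_inv]; exact hf
    · exact Or.inr ⟨f, hf, hf', hy.tail ⟨g, h1, h2, rfl, rfl⟩⟩

theorem IsTree.exists_flag (hG : G.IsTree) (x : G.V) (s : S) :
    ∃ f, G.bd f = x ∧ s ∈ G.branch f := by
  rcases hG.exists_toward x (G.bd (G.label s)) with h | ⟨f, h1, h2, h3⟩
  · exact ⟨_, h, Or.inl rfl⟩
  · exact ⟨f, h1, (mem_branch_edge h2 s).2 h3⟩

/-- The branches that start at a vertex are disjoint. -/
theorem IsTree.flag_unique (hG : G.IsTree) {f g : G.F} (h : G.bd f = G.bd g) {s : S}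
    (hf : s ∈ G.branch f) (hg : s ∈ G.branch g) : f = g := by
  rcases eq_or_ne (G.inv f) f with tf | tf
  · have ef := branch_tail tf hf
    rcases eq_or_ne (G.inv g) g with tg | tg
    · exact ef.symm.trans (branch_tail tg hg)
    · rw [mem_branch_edge tg, ef, h] at hg
      exact absurd hg.symm (hG.bridge g tg)
  · rcases eq_or_ne (G.inv g) g with tg | tg
    · rw [mem_branch_edge tf, branch_tail tg hg, ← h] at hf
      exact absurd hf.symm (hG.bridge f tf)
    · by_contra hne
      rw [mem_branch_edge tf] at hf
      rw [mem_branch_edge tg] at hg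
      have := hG.side_subset (inv_ne tf) tg (by rw [G.inv_inv, h])
        (by rw [G.inv_inv]; exact Ne.symm hne) _ hg
      rw [G.inv_inv, reachOff_inv] at this
      exact hG.bridge f tf (Relation.ReflTransGen.trans this hf.symm)

theorem IsTree.disjoint_branch (hG : G.IsTree) {f g : G.F} (h : G.bd f = G.bd g) (hne : f ≠ g) :
    Disjoint (G.branch f) (G.branch g) :=
  Set.disjoint_left.2 fun _ hf hg => hne (hG.flag_unique h hf hg)

theorem IsTree.bd_inv_ne (hG : G.IsTree) {f : G.F} (hf : G.inv f ≠ f) :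
    G.bd (G.inv f) ≠ G.bd f :=
  fun h => hG.bridge f hf (by rw [h]; exact .refl)

theorem branch_label (s : S) : G.branch (G.label s) = {s} := by
  ext t
  constructor
  · intro h
    exact G.label.injective (Subtype.ext (branch_tail (G.label s).2 h))
  · rintro rfl; exact Or.inl rfl

theorem exists_label {f : G.F} (hf : G.inv f = f) : ∃ s, (G.label s : G.F) = f :=
  ⟨G.label.symm ⟨f, hf⟩, by simp⟩

/-- If `x` lies beyond the flag `f`, then one flag at `x` points back to `f`; its branch contains
all labels on the other side of the edge of `f`. -/
theorem IsTree.exists_compl_subset (hG : G.IsTree) {f : G.F} (hf : G.inv f ≠ f) {x : G.V}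
    (hx : G.ReachOff f (G.bd (G.inv f)) x) :
    ∃ h, G.bd h = x ∧ G.inv h ≠ h ∧ (G.branch f)ᶜ ⊆ G.branch h := by
  have hnot : ¬ G.ReachOff f (G.bd f) x := fun h =>
    hG.bridge f hf (Relation.ReflTransGen.trans h hx.symm)
  rcases hG.exists_toward x (G.bd f) with h | ⟨h, h1, h2, h3⟩
  · exact absurd (by rw [h]; exact .refl) hnot
  refine ⟨h, h1, h2, fun s hs => ?_⟩
  rw [← hG.branch_inv hf, mem_branch_edge (inv_ne hf), G.inv_inv, reachOff_inv] at hs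
  rw [mem_branch_edge h2]
  refine Relation.ReflTransGen.trans h3 ?_
  generalize G.bd (G.label s) = y at hs
  induction hs with
  | refl => exact .refl
  | @tail y z hy hz ih =>
    have hz' := hy.tail hz
    obtain ⟨g, g1, g2, rfl, rfl⟩ := hz
    refine ih.tail ⟨g, ?_, ?_, rfl, rfl⟩
    · rintro rfl; exact hnot (h1 ▸ hy)
    · rintro rfl; rw [G.inv_inv, h1] at hz'; exact hnot hz'

/-- Seen from any vertex, one side of a given edge is contained in a single branch. -/
theorem IsTree.exists_subset_or (hG : G.IsTree) {f : G.F} (hf : G.inv f ≠ f) (x : G.V) :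
    ∃ h, G.bd h = x ∧ (G.branch f ⊆ G.branch h ∨ (G.branch f)ᶜ ⊆ G.branch h) := by
  rcases hG.cover f x with h | h
  · obtain ⟨g, h1, _, h3⟩ := hG.exists_compl_subset (f := G.inv f) (inv_ne hf) (x := x)
      (by rw [G.inv_inv, reachOff_inv]; exact h)
    rw [hG.branch_inv hf, compl_compl] at h3
    exact ⟨g, h1, Or.inl h3⟩
  · obtain ⟨g, h1, _, h3⟩ := hG.exists_compl_subset hf h
    exact ⟨g, h1, Or.inr h3⟩

end SGraph

namespace PSTree

open SGraph

variable {S : Type u} {W : Set S} (τ : PSTree W)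

theorem branch_nonempty (f : τ.graph.F) : (τ.graph.branch f).Nonempty := by
  by_cases hf : τ.graph.inv f = f
  · obtain ⟨s, rfl⟩ := exists_label hf
    exact ⟨s, Or.inl rfl⟩
  · exact (τ.stablePart_branch f hf).1.nonempty

theorem exists_third (f g : τ.graph.F) :
    ∃ h, τ.graph.bd h = τ.graph.bd f ∧ h ≠ f ∧ h ≠ g := by
  have := τ.graph.finite_F
  obtain ⟨t, ht, ht'⟩ := Set.exists_mem_notMem_of_ncard_lt_ncard
    (s := ({f, g} : Set τ.graph.F)) (t := {h | τ.graph.bd h = τ.graph.bd f}) (by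
      have h1 := Set.ncard_insert_le f {g}
      have h2 := τ.stable.stable (τ.graph.bd f)
      rw [Set.ncard_singleton] at h1
      omega)
  simp only [Set.mem_insert_iff, Set.mem_singleton_iff, not_or] at ht'
  exact ⟨t, ht, ht'⟩

theorem exists_notMem_branches {f g : τ.graph.F} (h : τ.graph.bd f = τ.graph.bd g) :
    ∃ s, s ∉ τ.graph.branch f ∧ s ∉ τ.graph.branch g := by
  obtain ⟨p, h1, h2, h3⟩ := τ.exists_third f g
  obtain ⟨s, hs⟩ := τ.branch_nonempty p
  exact ⟨s, fun hf => h2 (τ.stable.tree.flag_unique h1 hs hf),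
    fun hg => h3 (τ.stable.tree.flag_unique (h1.trans h) hs hg)⟩

theorem subset_compl_branch {f g : τ.graph.F} (h : τ.graph.bd f = τ.graph.bd g) (hne : f ≠ g) :
    τ.graph.branch f ⊆ (τ.graph.branch g)ᶜ :=
  (τ.stable.tree.disjoint_branch h hne).subset_compl_right

theorem eq_of_branch_subset {f g : τ.graph.F} (h : τ.graph.bd f = τ.graph.bd g)
    {A : Set S} (hA : A.Nonempty) (h1 : A ⊆ τ.graph.branch f) (h2 : A ⊆ τ.graph.branch g) :
    f = g := by
  obtain ⟨s, hs⟩ := hA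
  exact τ.stable.tree.flag_unique h (h1 hs) (h2 hs)

/-- The partitions of `S` defined by two edges do not cross. -/
theorem branch_nested {f : τ.graph.F} (hf : τ.graph.inv f ≠ f) (g : τ.graph.F) :
    τ.graph.branch f ⊆ τ.graph.branch g ∨ τ.graph.branch f ⊆ (τ.graph.branch g)ᶜ ∨
      (τ.graph.branch f)ᶜ ⊆ τ.graph.branch g ∨ (τ.graph.branch f)ᶜ ⊆ (τ.graph.branch g)ᶜ := by
  obtain ⟨h, h1, h2⟩ := τ.stable.tree.exists_subset_or hf (τ.graph.bd g)
  by_cases hg : h = g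
  · subst hg; tauto
  · have := τ.subset_compl_branch h1 hg
    exact h2.elim (fun h => Or.inr (Or.inl (h.trans this)))
      (fun h => Or.inr (Or.inr (Or.inr (h.trans this))))

theorem branch_inv_nonempty {f : τ.graph.F} (hf : τ.graph.inv f ≠ f) :
    ((τ.graph.branch f)ᶜ).Nonempty := by
  rw [← τ.stable.tree.branch_inv hf]; exact τ.branch_nonempty _

/-- A flag is determined by the labels on its branch. -/
theorem branch_injective : Function.Injective τ.graph.branch := by
  have hG := τ.stable.tree
  have tail_edge : ∀ f g, τ.graph.inv f = f → τ.graph.inv g ≠ g →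
      τ.graph.branch f ≠ τ.graph.branch g := by
    intro f g hf hg h
    obtain ⟨s, rfl⟩ := exists_label hf
    have := (τ.stablePart_branch g hg).1
    rw [← h, branch_label] at this
    exact Set.not_nontrivial_singleton this
  intro f g hfg
  by_cases hf : τ.graph.inv f = f
  · by_cases hg : τ.graph.inv g = g
    · obtain ⟨s, rfl⟩ := exists_label hf
      obtain ⟨t, rfl⟩ := exists_label hg
      rw [branch_label, branch_label, Set.singleton_eq_singleton_iff] at hfg
      rw [hfg]
    · exact absurd hfg (tail_edge f g hf hg)
  by_cases hg : τ.graph.inv g = g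
  · exact absurd hfg.symm (tail_edge g f hg hf)
  by_contra hne
  -- the starting point of `g` lies on the same side of the edge of `f` as that of `f`
  have side : ∀ f g, τ.graph.inv f ≠ f → τ.graph.inv g ≠ g →
      τ.graph.branch f = τ.graph.branch g →
      τ.graph.ReachOff f (τ.graph.bd f) (τ.graph.bd g) := by
    intro f g hf hg hfg
    refine (hG.cover f _).resolve_right fun h => ?_
    obtain ⟨p, h1, -, h3⟩ := hG.exists_compl_subset hf h
    by_cases hp : p = g
    · subst hp
      obtain ⟨s, hs⟩ := τ.branch_inv_nonempty hf
      exact hs (hfg ▸ h3 hs)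
    · obtain ⟨s, hs, hs'⟩ := τ.exists_notMem_branches h1
      exact hs (h3 (hfg ▸ hs'))
  have s1 := side f g hf hg hfg
  have s2 := side _ _ (inv_ne hf) (inv_ne hg) (by rw [hG.branch_inv hf, hG.branch_inv hg, hfg])
  rw [reachOff_inv] at s2
  have st : τ.graph.StepOff f (τ.graph.bd g) (τ.graph.bd (τ.graph.inv g)) := by
    refine ⟨g, Ne.symm hne, fun h => ?_, rfl, rfl⟩
    rw [h, hG.branch_inv hf] at hfg
    obtain ⟨s, hs⟩ := τ.branch_nonempty f
    exact (hfg ▸ hs : s ∈ (τ.graph.branch f)ᶜ) hs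
  exact hG.bridge f hf ((s1.tail st).trans s2.symm)

/-- Whether two flags start at the same vertex can be read off from the branches: they do if the
branches are disjoint, do not cover `S`, and no edge lies between them. -/
theorem bd_eq_iff {f g : τ.graph.F} (hne : f ≠ g) : τ.graph.bd f = τ.graph.bd g ↔
    Disjoint (τ.graph.branch f) (τ.graph.branch g) ∧
    (∃ s, s ∉ τ.graph.branch f ∧ s ∉ τ.graph.branch g) ∧
    ∀ h, τ.graph.inv h ≠ h → τ.graph.branch f ⊆ τ.graph.branch h →
      τ.graph.branch g ⊆ (τ.graph.branch h)ᶜ →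
      τ.graph.branch f = τ.graph.branch h ∨ τ.graph.branch g = (τ.graph.branch h)ᶜ := by
  have hG := τ.stable.tree
  constructor
  · intro hfg
    refine ⟨hG.disjoint_branch hfg hne, τ.exists_notMem_branches hfg, fun h hh hf hg => ?_⟩
    obtain ⟨p, h1, h2 | h2⟩ := hG.exists_subset_or hh (τ.graph.bd f)
    · have := τ.eq_of_branch_subset h1 (τ.branch_nonempty f) (hf.trans h2) subset_rfl
      subst this
      exact Or.inl (hf.antisymm h2)
    · have := τ.eq_of_branch_subset (h1.trans hfg) (τ.branch_nonempty g) (hg.trans h2) subset_rfl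
      subst this
      exact Or.inr (hg.antisymm h2)
  · rintro ⟨hd, ⟨s, hsf, hsg⟩, hsep⟩
    by_contra hbd
    rcases hG.exists_toward (τ.graph.bd f) (τ.graph.bd g) with h | ⟨h, h1, h2, h3⟩
    · exact hbd h.symm
    obtain ⟨p, p1, -, p3⟩ := hG.exists_compl_subset h2 h3
    by_cases hf : h = f
    · subst hf
      by_cases hp : p = g
      · subst hp; exact hsg (p3 hsf)
      · have e := τ.subset_compl_branch p1.symm (Ne.symm hp)
        obtain ⟨t, ht⟩ := τ.branch_nonempty g
        refine hd.le_bot ⟨?_, ht⟩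
        by_contra hc
        exact e ht (p3 hc)
    · have e1 := τ.subset_compl_branch h1.symm (Ne.symm hf)
      by_cases hp : p = g
      · subst hp
        obtain ⟨t, ht⟩ := τ.branch_nonempty f
        exact hd.le_bot ⟨ht, p3 (e1 ht)⟩
      · have e2 := τ.subset_compl_branch p1.symm (Ne.symm hp)
        have e3 : τ.graph.branch g ⊆ τ.graph.branch h :=
          e2.trans (Set.compl_subset_comm.1 p3)
        have e4 := hG.branch_inv h2
        rcases hsep (τ.graph.inv h) (inv_ne h2) (by rwa [e4]) (by rwa [e4, compl_compl]) with e | e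
        · exact hG.bd_inv_ne h2 (by rw [← τ.branch_injective e, h1])
        · rw [e4, compl_compl] at e
          exact hbd (by rw [τ.branch_injective e, h1])

/-- Two trees with the same branches are isomorphic. -/
theorem nonempty_iso {τ τ' : PSTree W}
    (h : ∀ f, τ.graph.inv f ≠ f → ∃ g, τ'.graph.branch g = τ.graph.branch f)
    (h' : ∀ g, τ'.graph.inv g ≠ g → ∃ f, τ.graph.branch f = τ'.graph.branch g) :
    Nonempty (τ.graph.Iso τ'.graph) := by
  have ext : ∀ {τ τ' : PSTree W},
      (∀ f, τ.graph.inv f ≠ f → ∃ g, τ'.graph.branch g = τ.graph.branch f) →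
      ∀ f, ∃ g, τ'.graph.branch g = τ.graph.branch f := by
    intro τ τ' h f
    by_cases hf : τ.graph.inv f = f
    · obtain ⟨s, rfl⟩ := exists_label hf
      exact ⟨τ'.graph.label s, by rw [branch_label, branch_label]⟩
    · exact h f hf
  choose φ hφ using ext h
  choose ψ hψ using ext h'
  have φψ : ∀ g, φ (ψ g) = g := fun g => τ'.branch_injective (by rw [hφ, hψ])
  have ψφ : ∀ f, ψ (φ f) = f := fun f => τ.branch_injective (by rw [hψ, hφ])
  have inv_aux : ∀ {τ τ' : PSTree W} {f : τ.graph.F} {g : τ'.graph.F},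
      τ.graph.branch f = τ'.graph.branch g → τ.graph.inv f = f → τ'.graph.inv g = g := by
    intro τ τ' f g e hf
    by_contra hg
    obtain ⟨s, rfl⟩ := exists_label hf
    have := (τ'.stablePart_branch g hg).1
    rw [← e, branch_label] at this
    exact Set.not_nontrivial_singleton this
  have hinv : ∀ f, τ'.graph.inv (φ f) = φ (τ.graph.inv f) := by
    intro f
    by_cases hf : τ.graph.inv f = f
    · rw [hf]; exact inv_aux (hφ f).symm hf
    · have hf' : τ'.graph.inv (φ f) ≠ φ f := fun e => hf (inv_aux (hφ f) e)
      apply τ'.branch_injective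
      rw [τ'.stable.tree.branch_inv hf', hφ, hφ, τ.stable.tree.branch_inv hf]
  have bd_aux : ∀ {τ τ' : PSTree W} (φ : τ.graph.F → τ'.graph.F) (ψ : τ'.graph.F → τ.graph.F),
      (∀ f, τ'.graph.branch (φ f) = τ.graph.branch f) →
      (∀ g, τ.graph.branch (ψ g) = τ'.graph.branch g) → (∀ f, ψ (φ f) = f) →
      ∀ f g, τ.graph.bd f = τ.graph.bd g → τ'.graph.bd (φ f) = τ'.graph.bd (φ g) := by
    intro τ τ' φ ψ hφ hψ ψφ f g hfg
    by_cases hne : f = g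
    · rw [hne]
    have hne' : φ f ≠ φ g := fun e => hne (by rw [← ψφ f, e, ψφ])
    rw [τ.bd_eq_iff hne] at hfg
    rw [τ'.bd_eq_iff hne']
    obtain ⟨h1, h2, h3⟩ := hfg
    refine ⟨by rwa [hφ, hφ], by rwa [hφ, hφ], fun p hp => ?_⟩
    rw [hφ, hφ, ← hψ p]
    exact h3 _ fun e => hp (inv_aux (hψ p) e)
  have up : ∀ (τ : PSTree W) (x : τ.graph.V), ∃ f, τ.graph.bd f = x := by
    intro τ x
    have := τ.stable.stable x
    by_contra hc
    push Not at hc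
    rw [Set.eq_empty_of_forall_notMem (s := {f | τ.graph.bd f = x}) fun f hf => hc f hf,
      Set.ncard_empty] at this
    omega
  choose u hu using up τ
  choose u' hu' using up τ'
  have b1 := bd_aux φ ψ hφ hψ ψφ
  have b2 := bd_aux ψ φ hψ hφ φψ
  refine ⟨⟨⟨fun x => τ'.graph.bd (φ (u x)), fun y => τ.graph.bd (ψ (u' y)), fun x => ?_,
    fun y => ?_⟩, ⟨φ, ψ, ψφ, φψ⟩, fun f => ?_, hinv, fun s => ?_⟩⟩
  · have := b2 _ _ (hu' (τ'.graph.bd (φ (u x))))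
    simp only at this ⊢
    rw [this, ψφ, hu]
  · have := b1 _ _ (hu (τ.graph.bd (ψ (u' y))))
    simp only at this ⊢
    rw [this, φψ, hu']
  · exact b1 _ _ (hu _).symm
  · apply τ'.branch_injective
    simp only [Equiv.coe_fn_mk]
    rw [hφ, branch_label, branch_label]

end PSTree

open SGraph

variable {S : Type u} {W : Set S}

/-! ### Crossing partitions -/

namespace StablePartition

/-- `A` is one of the two parts of the partition. -/
def IsPart (σ : StablePartition W) (A : Set S) : Prop := σ.1 = s(A, Aᶜ)

variable {σ σ' : StablePartition W} {A B : Set S}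

theorem IsPart.compl (h : σ.IsPart A) : σ.IsPart Aᶜ := by
  rw [IsPart, compl_compl, Sym2.eq_swap]; exact h

theorem IsPart.eq_or (h : σ.IsPart A) (h' : σ.IsPart B) : B = A ∨ B = Aᶜ := by
  rw [IsPart] at h h'
  rw [h, Sym2.eq_iff] at h'
  rcases h' with h' | h'
  · exact Or.inl h'.1.symm
  · exact Or.inr h'.2.symm

theorem IsPart.ext (h : σ.IsPart A) (h' : σ'.IsPart A) : σ = σ' :=
  Subtype.ext (h.trans (Eq.symm h'))

theorem exists_isPart (σ : StablePartition W) : ∃ A, σ.IsPart A :=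
  let ⟨A, h, _⟩ := σ.2; ⟨A, h⟩

theorem exists_isPart_notMem (σ : StablePartition W) (r : S) : ∃ A, σ.IsPart A ∧ r ∉ A := by
  obtain ⟨A, h⟩ := σ.exists_isPart
  by_cases hr : r ∈ A
  · exact ⟨Aᶜ, h.compl, fun h => h hr⟩
  · exact ⟨A, h, hr⟩

theorem IsPart.stablePart (h : σ.IsPart A) : StablePart W A := by
  obtain ⟨B, hB, h1, h2⟩ := σ.2
  rcases IsPart.eq_or (σ := σ) hB h with rfl | rfl
  exacts [h1, h2]

theorem IsPart.separates_iff (h : σ.IsPart A) {i j k l : S} : σ.Separates i j k l ↔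
    (i ∈ A ∧ j ∈ A ∧ k ∉ A ∧ l ∉ A) ∨ (i ∉ A ∧ j ∉ A ∧ k ∈ A ∧ l ∈ A) := by
  constructor
  · rintro ⟨B, hB, h1⟩
    rcases h.eq_or hB with rfl | rfl
    · exact Or.inl h1
    · right; simpa using h1
  · rintro (h1 | h1)
    · exact ⟨A, h, h1⟩
    · exact ⟨Aᶜ, h.compl, by simpa using h1⟩

/-- The product of the variables of `σ` and `σ'` is one of the quadratic relations. -/
def Cross (σ σ' : StablePartition W) : Prop :=
  ∃ a b c d, Allowed W a b c d ∧ σ.Separates a b c d ∧ σ'.Separates c b a d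

/-- Two partitions cross if and only if all four intersections of their parts are nonempty.
By stability each part contains a white label, so two opposite intersections contain white
labels; this makes the quadruple allowed. -/
theorem cross_iff (hA : σ.IsPart A) (hB : σ'.IsPart B) : σ.Cross σ' ↔
    (A ∩ B).Nonempty ∧ (A ∩ Bᶜ).Nonempty ∧ (Aᶜ ∩ B).Nonempty ∧ (Aᶜ ∩ Bᶜ).Nonempty := by
  constructor
  · rintro ⟨a, b, c, d, -, h1, h2⟩
    rw [hA.separates_iff] at h1
    rw [hB.separates_iff] at h2
    rcases h1 with ⟨a1, b1, c1, d1⟩ | ⟨a1, b1, c1, d1⟩ <;>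
      rcases h2 with ⟨c2, b2, a2, d2⟩ | ⟨c2, b2, a2, d2⟩
    · exact ⟨⟨b, b1, b2⟩, ⟨a, a1, a2⟩, ⟨c, c1, c2⟩, ⟨d, d1, d2⟩⟩
    · exact ⟨⟨a, a1, a2⟩, ⟨b, b1, b2⟩, ⟨d, d1, d2⟩, ⟨c, c1, c2⟩⟩
    · exact ⟨⟨c, c1, c2⟩, ⟨d, d1, d2⟩, ⟨b, b1, b2⟩, ⟨a, a1, a2⟩⟩
    · exact ⟨⟨d, d1, d2⟩, ⟨c, c1, c2⟩, ⟨a, a1, a2⟩, ⟨b, b1, b2⟩⟩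
  · rintro ⟨⟨b, b1, b2⟩, ⟨a, a1, a2⟩, ⟨c, c1, c2⟩, ⟨d, d1, d2⟩⟩
    suffices H : ∃ a b c d, (a ∈ A ∧ a ∉ B) ∧ (b ∈ A ∧ b ∈ B) ∧ (c ∉ A ∧ c ∈ B) ∧
        (d ∉ A ∧ d ∉ B) ∧ ((a ∈ W ∧ c ∈ W) ∨ (b ∈ W ∧ d ∈ W)) by
      obtain ⟨a, b, c, d, ⟨a1, a2⟩, ⟨b1, b2⟩, ⟨c1, c2⟩, ⟨d1, d2⟩, hw⟩ := H
      have ne : ∀ {x y : S} {X : Set S}, x ∈ X → y ∉ X → x ≠ y := fun h h' e => h' (e ▸ h)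
      refine ⟨a, b, c, d, ⟨?_, ?_, ?_, ?_, ?_⟩, hA.separates_iff.2 (Or.inl ⟨a1, b1, c1, d1⟩),
        hB.separates_iff.2 (Or.inl ⟨c2, b2, a2, d2⟩)⟩
      · simp [(ne b2 a2).symm, ne a1 c1, ne a1 d1, ne b1 c1, ne b1 d1, ne c2 d2]
      all_goals tauto
    by_cases h : (∃ x, x ∈ A ∧ x ∈ B ∧ x ∈ W) ∧ (∃ x, x ∉ A ∧ x ∉ B ∧ x ∈ W)
    · obtain ⟨⟨b', e1, e2, e3⟩, d', e4, e5, e6⟩ := h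
      exact ⟨a, b', c, d', ⟨a1, a2⟩, ⟨e1, e2⟩, ⟨c1, c2⟩, ⟨e4, e5⟩, Or.inr ⟨e3, e6⟩⟩
    · suffices H : ∃ a c, (a ∈ A ∧ a ∉ B ∧ a ∈ W) ∧ (c ∉ A ∧ c ∈ B ∧ c ∈ W) by
        obtain ⟨a', c', ⟨e1, e2, e3⟩, e4, e5, e6⟩ := H
        exact ⟨a', b, c', d, ⟨e1, e2⟩, ⟨b1, b2⟩, ⟨e4, e5⟩, ⟨d1, d2⟩, Or.inl ⟨e3, e6⟩⟩
      obtain ⟨w1, w1A, w1W⟩ := hA.stablePart.2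
      obtain ⟨w2, w2A, w2W⟩ := hA.compl.stablePart.2
      obtain ⟨w3, w3B, w3W⟩ := hB.stablePart.2
      obtain ⟨w4, w4B, w4W⟩ := hB.compl.stablePart.2
      rw [Set.mem_compl_iff] at w2A w4B
      rcases not_and_or.1 h with h | h <;> push Not at h
      · refine ⟨w1, w3, ⟨w1A, fun hB => h _ w1A hB w1W, w1W⟩, fun hA => h _ hA w3B w3W, w3B, w3W⟩
      · refine ⟨w4, w2, ⟨by_contra fun hA => h _ hA w4B w4W, w4B, w4W⟩, w2A,
          by_contra fun hB => h _ w2A hB w2W, w2W⟩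

theorem Cross.symm (h : σ.Cross σ') : σ'.Cross σ := by
  obtain ⟨a, b, c, d, ⟨h1, h2, h3, h4, h5⟩, h6, h7⟩ := h
  refine ⟨c, b, a, d, ⟨?_, h4, h5, h2, h3⟩, h7, h6⟩
  simp only [List.nodup_cons, List.mem_cons, List.not_mem_nil, or_false, not_or, not_false_eq_true,
    List.nodup_nil, and_true] at h1 ⊢
  tauto

theorem not_cross_iff (hA : σ.IsPart A) (hB : σ'.IsPart B) : ¬ σ.Cross σ' ↔
    A ⊆ B ∨ A ⊆ Bᶜ ∨ Aᶜ ⊆ B ∨ Aᶜ ⊆ Bᶜ := by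
  rw [cross_iff hA hB]
  simp only [not_and_or, Set.not_nonempty_iff_eq_empty, ← Set.disjoint_iff_inter_eq_empty,
    ← Set.subset_compl_iff_disjoint_right, compl_compl]
  tauto

end StablePartition

open StablePartition

/-- A set of pairwise non-crossing partitions. -/
def IsFace (F : Finset (StablePartition W)) : Prop := ∀ σ ∈ F, ∀ σ' ∈ F, ¬ σ.Cross σ'

theorem IsFace.mono {F G : Finset (StablePartition W)} (h : F ⊆ G) (hG : IsFace G) : IsFace F :=
  fun σ hσ σ' hσ' => hG σ (h hσ) σ' (h hσ')

theorem not_cross_self (σ : StablePartition W) : ¬ σ.Cross σ := by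
  obtain ⟨A, hA⟩ := σ.exists_isPart
  rw [not_cross_iff hA hA]
  exact Or.inl subset_rfl

/-! ### The partitions defined by the edges of a tree -/

namespace PSTree

variable (τ : PSTree W)

open Classical in
/-- The set of the partitions defined by the edges. -/
noncomputable def splits : Finset (StablePartition W) := Finset.univ.image τ.edgePartition

variable {τ}

theorem edgePartition_isPart {f : τ.graph.F} (hf : τ.graph.inv f ≠ f) :
    (τ.edgePartition (τ.graph.edgeOf f hf)).IsPart (τ.graph.branch f) := by
  rw [IsPart, ← τ.stable.tree.branch_inv hf]; rfl

theorem mem_splits {σ : StablePartition W} :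
    σ ∈ τ.splits ↔ ∃ f, τ.graph.inv f ≠ f ∧ σ.IsPart (τ.graph.branch f) := by
  simp only [splits, Finset.mem_image, Finset.mem_univ, true_and]
  constructor
  · rintro ⟨⟨_, f, hf, rfl⟩, rfl⟩
    exact ⟨f, hf, edgePartition_isPart hf⟩
  · rintro ⟨f, hf, h⟩
    exact ⟨τ.graph.edgeOf f hf, (edgePartition_isPart hf).ext h⟩

theorem edgePartition_injective : Function.Injective τ.edgePartition := by
  rintro ⟨_, f, hf, rfl⟩ ⟨_, g, hg, rfl⟩ h
  have h1 := edgePartition_isPart hf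
  have h2 : (τ.edgePartition (τ.graph.edgeOf f hf)).IsPart (τ.graph.branch g) := by
    have h' : τ.edgePartition (τ.graph.edgeOf f hf) = τ.edgePartition (τ.graph.edgeOf g hg) := h
    rw [h']; exact edgePartition_isPart hg
  apply Subtype.ext
  change s(f, τ.graph.inv f) = s(g, τ.graph.inv g)
  rcases h1.eq_or h2 with e | e
  · rw [τ.branch_injective e]
  · rw [← τ.stable.tree.branch_inv hf] at e
    rw [τ.branch_injective e, τ.graph.inv_inv, Sym2.eq_swap]

theorem isFace_splits : IsFace τ.splits := by
  intro σ hσ σ' hσ'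
  obtain ⟨f, hf, hσ⟩ := mem_splits.1 hσ
  obtain ⟨g, hg, hσ'⟩ := mem_splits.1 hσ'
  rw [not_cross_iff hσ hσ']
  exact τ.branch_nested hf g

theorem nonempty_iso_of_splits_eq {τ τ' : PSTree W} (h : τ.splits = τ'.splits) :
    Nonempty (τ.graph.Iso τ'.graph) := by
  have aux : ∀ {τ τ' : PSTree W}, τ.splits = τ'.splits → ∀ f, τ.graph.inv f ≠ f →
      ∃ g, τ'.graph.branch g = τ.graph.branch f := by
    intro τ τ' h f hf
    have := mem_splits.2 ⟨f, hf, edgePartition_isPart hf⟩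
    rw [h] at this
    obtain ⟨g, hg, hg'⟩ := mem_splits.1 this
    rcases (edgePartition_isPart hf).eq_or hg' with e | e
    · exact ⟨g, e⟩
    · exact ⟨τ'.graph.inv g, by rw [τ'.stable.tree.branch_inv hg, e, compl_compl]⟩
  exact nonempty_iso (aux h) (aux h.symm)

end PSTree

/-! ### Inserting an edge -/

theorem SGraph.branch_split_subset {G : SGraph S} (x : G.V) (A : Set G.F)
    (hA : ∀ f ∈ A, G.bd f = x) (f : G.F) :
    (G.split x A).branch (Sum.inl f : G.F ⊕ Bool) ⊆ G.branch f := by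
  have pr : ∀ g, ((G.split x A).bd (Sum.inl g) : Option G.V).getD x = G.bd g := by
    intro g
    by_cases hg : g ∈ A
    · rw [show (G.split x A).bd (Sum.inl g) = none from if_pos hg, hA g hg]; rfl
    · rw [show (G.split x A).bd (Sum.inl g) = some (G.bd g) from if_neg hg]; rfl
  have key : ∀ a b : Option G.V, (G.split x A).ReachOff (Sum.inl f) a b →
      G.ReachOff f (a.getD x) (b.getD x) := by
    intro a b h
    induction h with
    | refl => exact .refl
    | tail _ h ih =>
      obtain ⟨g, h1, h2, rfl, rfl⟩ := h
      rcases g with g | b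
      · refine Relation.ReflTransGen.tail ih ⟨g, fun h => h1 (congrArg Sum.inl h),
          fun h => h2 (congrArg Sum.inl h), (pr g).symm, (pr (G.inv g)).symm⟩
      · cases b <;> exact ih
  rintro s (h | ⟨h1, h2⟩)
  · exact Or.inl (Sum.inl.inj h)
  · refine Or.inr ⟨fun h => h1 (congrArg Sum.inl h), ?_⟩
    have := key _ _ h2
    rwa [← pr (G.inv f), ← pr (G.label s)]

namespace VertexPartition

variable {τ : PSTree W} {x : τ.graph.V} (α : VertexPartition τ x)

/-- The part of `S` which corresponds to the given part of `α`. -/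
def labels : Set S := {s | ∃ f ∈ α.part, s ∈ τ.graph.branch f}

/-- A flag of `τ`, as a flag of `τ(α)`. -/
def old (f : τ.graph.F) : (τ.insert α).graph.F := (Sum.inl f : τ.graph.F ⊕ Bool)

/-- The two halves of the new edge of `τ(α)`; `new true` starts at the end that carries the flags of
the given part. -/
def new (b : Bool) : (τ.insert α).graph.F := (Sum.inr b : τ.graph.F ⊕ Bool)

theorem inv_old (f : τ.graph.F) : (τ.insert α).graph.inv (α.old f) = α.old (τ.graph.inv f) := rfl

theorem inv_new (b : Bool) : (τ.insert α).graph.inv (α.new b) = α.new (!b) := rfl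

theorem old_injective : Function.Injective α.old := fun _ _ h => Sum.inl.inj h

theorem inv_new_ne (b : Bool) : (τ.insert α).graph.inv (α.new b) ≠ α.new b := by
  rw [inv_new]
  intro h
  have : (!b) = b := Sum.inr.inj h
  cases b <;> cases this

theorem branch_old (f : τ.graph.F) : (τ.insert α).graph.branch (α.old f) = τ.graph.branch f := by
  have sub : ∀ f, (τ.insert α).graph.branch (α.old f) ⊆ τ.graph.branch f :=
    SGraph.branch_split_subset x α.part α.at_vertex
  by_cases hf : τ.graph.inv f = f
  · obtain ⟨s, rfl⟩ := exists_label hf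
    refine (sub _).antisymm ?_
    rw [branch_label]
    rintro t rfl
    exact Or.inl rfl
  · refine (sub f).antisymm ?_
    have h1 := sub (τ.graph.inv f)
    have hf' : (τ.insert α).graph.inv (α.old f) ≠ α.old f := fun h => hf (α.old_injective h)
    rw [τ.stable.tree.branch_inv hf, ← inv_old, (τ.insert α).stable.tree.branch_inv hf'] at h1
    exact Set.compl_subset_compl.1 h1

theorem branch_new_true : (τ.insert α).graph.branch (α.new true) = α.labelsᶜ := by
  have hG := (τ.insert α).stable.tree
  have ht : (τ.insert α).graph.bd (α.new true) = (none : Option τ.graph.V) := rfl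
  have hold : ∀ f, (τ.insert α).graph.bd (α.old f) = (none : Option τ.graph.V) ↔ f ∈ α.part := by
    intro f
    constructor
    · intro h
      by_contra hf
      have : (τ.insert α).graph.bd (α.old f) = some (τ.graph.bd f) := if_neg hf
      rw [this] at h
      exact absurd h (by simp)
    · intro h; exact if_pos h
  ext s
  constructor
  · rintro hs ⟨f, hf, hsf⟩
    rw [← α.branch_old] at hsf
    have := hG.flag_unique (((hold f).2 hf).trans ht.symm) hsf hs
    exact Sum.inl_ne_inr this
  · intro hs
    obtain ⟨f, hf, hsf⟩ := hG.exists_flag (none : Option τ.graph.V) s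
    rcases f with f | b
    · exact absurd ⟨f, (hold f).1 hf, by rw [← α.branch_old]; exact hsf⟩ hs
    · cases b
      · exact absurd (show (some x : Option τ.graph.V) = none from hf) (by simp)
      · exact hsf

theorem isPart_labels : (τ.vertexPartition α).IsPart α.labels := by
  have := (PSTree.edgePartition_isPart (α.inv_new_ne true)).compl
  rwa [branch_new_true, compl_compl] at this

open Classical in
theorem splits_insert : (τ.insert α).splits = insert (τ.vertexPartition α) τ.splits := by
  ext σ
  rw [Finset.mem_insert, PSTree.mem_splits, PSTree.mem_splits]
  constructor
  · rintro ⟨f, hf, hσ⟩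
    rcases f with f | b
    · refine Or.inr ⟨f, fun h => hf (congrArg α.old h), ?_⟩
      rw [← α.branch_old]; exact hσ
    · left
      have h1 := PSTree.edgePartition_isPart (α.inv_new_ne true)
      cases b
      · have h2 : σ.IsPart ((τ.insert α).graph.branch (α.new true))ᶜ := by
          rw [← (τ.insert α).stable.tree.branch_inv (α.inv_new_ne true)]
          exact hσ
        exact h2.ext h1.compl
      · exact IsPart.ext hσ h1
  · rintro (rfl | ⟨f, hf, hσ⟩)
    · exact ⟨α.new true, α.inv_new_ne true, PSTree.edgePartition_isPart (α.inv_new_ne true)⟩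
    · exact ⟨α.old f, fun h => hf (α.old_injective h), by rwa [α.branch_old]⟩

theorem notMem_splits : τ.vertexPartition α ∉ τ.splits := by
  intro h
  obtain ⟨f, hf, hσ⟩ := PSTree.mem_splits.1 h
  have h1 : (τ.vertexPartition α).IsPart ((τ.insert α).graph.branch (α.new true)) :=
    PSTree.edgePartition_isPart (α.inv_new_ne true)
  rw [← α.branch_old] at hσ
  rcases h1.eq_or hσ with e | e
  · exact Sum.inl_ne_inr ((τ.insert α).branch_injective e)
  · rw [← (τ.insert α).stable.tree.branch_inv (α.inv_new_ne true)] at e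
    exact Sum.inl_ne_inr ((τ.insert α).branch_injective e)

theorem branch_subset_labels {f : τ.graph.F} (hf : f ∈ α.part) :
    τ.graph.branch f ⊆ α.labels := fun _ hs => ⟨f, hf, hs⟩

theorem branch_subset_compl_labels {f : τ.graph.F} (hx : τ.graph.bd f = x) (hf : f ∉ α.part) :
    τ.graph.branch f ⊆ α.labelsᶜ := by
  rintro s hs ⟨g, hg, hsg⟩
  rw [τ.stable.tree.flag_unique (hx.trans (α.at_vertex g hg).symm) hs hsg] at hf
  exact hf hg

theorem mem_part_iff {f : τ.graph.F} (hx : τ.graph.bd f = x) {s : S}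
    (hs : s ∈ τ.graph.branch f) : s ∈ α.labels ↔ f ∈ α.part :=
  ⟨fun h => by_contra fun hf => α.branch_subset_compl_labels hx hf hs h,
    fun h => α.branch_subset_labels h hs⟩

theorem ext_of_labels {α β : VertexPartition τ x} (h : α.labels = β.labels) : α = β := by
  have : α.part = β.part := by
    ext f
    have aux : ∀ {α β : VertexPartition τ x}, α.labels = β.labels → f ∈ α.part → f ∈ β.part := by
      intro α β h hf
      obtain ⟨s, hs⟩ := τ.branch_nonempty f
      exact (β.mem_part_iff (α.at_vertex f hf) hs).1 (h ▸ α.branch_subset_labels hf hs)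
    exact ⟨aux h, aux h.symm⟩
  cases α; cases β; congr

end VertexPartition

/-! ### Partitions breaking a vertex -/

namespace PSTree

variable {τ : PSTree W}

variable (τ) in
/-- The set `A` and its complement do not cut any branch starting at `x`. -/
def BreaksAt (x : τ.graph.V) (A : Set S) : Prop :=
  ∀ f, τ.graph.bd f = x → τ.graph.branch f ⊆ A ∨ τ.graph.branch f ⊆ Aᶜ

theorem breaksAt_labels {x : τ.graph.V} (α : VertexPartition τ x) : τ.BreaksAt x α.labels := by
  intro f hf
  by_cases h : f ∈ α.part
  · exact Or.inl (α.branch_subset_labels h)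
  · exact Or.inr (α.branch_subset_compl_labels hf h)

theorem BreaksAt.compl {x : τ.graph.V} {A : Set S} (h : τ.BreaksAt x A) : τ.BreaksAt x Aᶜ := by
  intro f hf
  rw [compl_compl]
  exact (h f hf).symm

/-- A partition that crosses no edge breaks some vertex: among the flags whose branch is cut choose
one with the smallest branch, and take the vertex at the other end of its edge. -/
theorem exists_breaksAt {A : Set S} (hA : ∀ f, τ.graph.inv f ≠ f →
    τ.graph.branch f ⊆ A ∨ τ.graph.branch f ⊆ Aᶜ ∨ (τ.graph.branch f)ᶜ ⊆ A ∨
      (τ.graph.branch f)ᶜ ⊆ Aᶜ) [Finite S] : ∃ x, τ.BreaksAt x A := by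
  by_contra hc
  simp only [BreaksAt, not_exists, not_forall] at hc
  have := τ.graph.finite_F
  obtain ⟨x₀⟩ := τ.stable.tree.nonempty
  obtain ⟨f₀, -, hf₀⟩ := hc x₀
  obtain ⟨f, hf, hmin⟩ := Set.exists_min_image
    {f | ¬ (τ.graph.branch f ⊆ A ∨ τ.graph.branch f ⊆ Aᶜ)} (fun f => (τ.graph.branch f).ncard)
    (Set.toFinite _) ⟨f₀, hf₀⟩
  have hfe : τ.graph.inv f ≠ f := by
    intro h
    obtain ⟨s, rfl⟩ := exists_label h
    apply hf
    rw [branch_label, Set.singleton_subset_iff, Set.singleton_subset_iff]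
    exact em _
  obtain ⟨g, hg, hgA⟩ := hc (τ.graph.bd (τ.graph.inv f))
  have hne : g ≠ τ.graph.inv f := by
    rintro rfl
    rw [τ.stable.tree.branch_inv hfe] at hgA
    have := hA f hfe
    simp only [Set.mem_ofPred_eq] at hf
    tauto
  have hsub := τ.subset_compl_branch hg hne
  rw [τ.stable.tree.branch_inv hfe, compl_compl] at hsub
  have hlt : (τ.graph.branch g).ncard < (τ.graph.branch f).ncard := by
    refine Set.ncard_lt_ncard (hsub.ssubset_of_ne fun e => ?_) (Set.toFinite _)
    rw [τ.branch_injective e] at hg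
    exact τ.stable.tree.bd_inv_ne hfe hg.symm
  exact absurd (hmin g hgA) (not_le.2 hlt)

/-- A stable partition that cuts no branch at `x` and is not defined by an edge has the form `σ_α`
for a stable partition `α` of the flags at `x`. -/
theorem exists_vertexPartition {x : τ.graph.V} {σ : StablePartition W} {A : Set S}
    (hσ : σ.IsPart A) (hn : σ ∉ τ.splits) (hx : τ.BreaksAt x A) :
    ∃ α : VertexPartition τ x, α.labels = A ∧ τ.vertexPartition α = σ := by
  have hG := τ.stable.tree
  -- a part is not exhausted by the branch of one flag, which would be an edge defining `σ`
  have two : ∀ {B : Set S}, σ.IsPart B → τ.BreaksAt x B →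
      {f | τ.graph.bd f = x ∧ τ.graph.branch f ⊆ B}.Nontrivial := by
    intro B hB hxB
    obtain ⟨s, hs⟩ := hB.stablePart.1.nonempty
    obtain ⟨f, hf, hsf⟩ := hG.exists_flag x s
    have hfB : τ.graph.branch f ⊆ B := (hxB f hf).resolve_right fun h => h hsf hs
    have : ∃ t ∈ B, t ∉ τ.graph.branch f := by
      by_contra hc
      push Not at hc
      have e : τ.graph.branch f = B := hfB.antisymm hc
      have hfe : τ.graph.inv f ≠ f := by
        intro h
        obtain ⟨s, rfl⟩ := exists_label h
        have := hB.stablePart.1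
        rw [← e, branch_label] at this
        exact Set.not_nontrivial_singleton this
      exact hn (mem_splits.2 ⟨f, hfe, e ▸ hB⟩)
    obtain ⟨t, ht, htf⟩ := this
    obtain ⟨g, hg, htg⟩ := hG.exists_flag x t
    exact ⟨f, ⟨hf, hfB⟩, g, ⟨hg, (hxB g hg).resolve_right fun h => h htg ht⟩,
      fun e => htf (e ▸ htg)⟩
  have white : ∀ {B : Set S}, σ.IsPart B → τ.BreaksAt x B →
      ∃ f, τ.graph.bd f = x ∧ τ.graph.branch f ⊆ B ∧ (τ.graph.branch f ∩ W).Nonempty := by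
    intro B hB hxB
    obtain ⟨s, hs, hsW⟩ := hB.stablePart.2
    obtain ⟨f, hf, hsf⟩ := hG.exists_flag x s
    exact ⟨f, hf, (hxB f hf).resolve_right fun h => h hsf hs, s, hsf, hsW⟩
  have out : ∀ f, τ.graph.branch f ⊆ Aᶜ → ¬ τ.graph.branch f ⊆ A := by
    intro f h h'
    obtain ⟨s, hs⟩ := τ.branch_nonempty f
    exact h hs (h' hs)
  let α : VertexPartition τ x :=
    { part := {f | τ.graph.bd f = x ∧ τ.graph.branch f ⊆ A}
      at_vertex := fun f hf => hf.1
      two_in := two hσ hx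
      two_out := (two hσ.compl hx.compl).mono fun f hf => ⟨hf.1, fun h => out f hf.2 h.2⟩
      white_in := by
        obtain ⟨f, h1, h2, h3⟩ := white hσ hx
        exact ⟨f, ⟨h1, h2⟩, h3⟩
      white_out := by
        obtain ⟨f, h1, h2, h3⟩ := white hσ.compl hx.compl
        exact ⟨f, h1, fun h => out f h2 h.2, h3⟩ }
  have hα : α.labels = A := by
    ext s
    constructor
    · rintro ⟨f, hf, hs⟩
      exact hf.2 hs
    · intro hs
      obtain ⟨f, hf, hsf⟩ := hG.exists_flag x s
      exact ⟨f, ⟨hf, (hx f hf).resolve_right fun h => h hsf hs⟩, hsf⟩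
  exact ⟨α, hα, (hα ▸ α.isPart_labels : IsPart _ A).ext hσ⟩

open Classical in
theorem nested_of_isFace_insert {σ : StablePartition W} {A : Set S} (hσ : σ.IsPart A)
    (h : IsFace (Insert.insert σ τ.splits)) {f : τ.graph.F} (hf : τ.graph.inv f ≠ f) :
    τ.graph.branch f ⊆ A ∨ τ.graph.branch f ⊆ Aᶜ ∨ (τ.graph.branch f)ᶜ ⊆ A ∨
      (τ.graph.branch f)ᶜ ⊆ Aᶜ := by
  rw [← not_cross_iff (edgePartition_isPart hf) hσ]
  exact h _ (Finset.mem_insert_of_mem (mem_splits.2 ⟨f, hf, edgePartition_isPart hf⟩)) _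
    (Finset.mem_insert_self _ _)

open Classical in
theorem exists_vertexPartition_of_isFace [Finite S] {σ : StablePartition W}
    (h : IsFace (Insert.insert σ τ.splits)) (hn : σ ∉ τ.splits) :
    ∃ (x : τ.graph.V) (α : VertexPartition τ x), τ.vertexPartition α = σ := by
  obtain ⟨A, hA⟩ := σ.exists_isPart
  obtain ⟨x, hx⟩ := exists_breaksAt fun f hf => nested_of_isFace_insert hA h hf
  obtain ⟨α, -, hα⟩ := exists_vertexPartition hA hn hx
  exact ⟨x, α, hα⟩

theorem splits_point [Finite S] (h3 : 3 ≤ Nat.card S) (hW : W.Nonempty) :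
    (PSTree.point h3 hW).splits = ∅ := by
  refine Finset.eq_empty_of_forall_notMem fun σ hσ => ?_
  obtain ⟨f, hf, -⟩ := mem_splits.1 hσ
  exact hf rfl

/-- Every set of pairwise non-crossing stable partitions is the set of edge partitions of a tree. -/
theorem exists_splits_eq [Finite S] (h3 : 3 ≤ Nat.card S) (hW : W.Nonempty)
    (F : Finset (StablePartition W)) (hF : IsFace F) : ∃ τ : PSTree W, τ.splits = F := by
  classical
  induction F using Finset.induction_on with
  | empty => exact ⟨_, splits_point h3 hW⟩
  | insert σ F hσ ih =>
    obtain ⟨τ, rfl⟩ := ih (hF.mono (Finset.subset_insert _ _))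
    obtain ⟨x, α, rfl⟩ := exists_vertexPartition_of_isFace hF hσ
    exact ⟨_, α.splits_insert⟩

open Classical in
/-- A sum over partitions of the flags at a vertex, as a sum over partitions of `S`. The labels
`i, j, k, l` are arbitrary representatives of the branches of the four flags. -/
theorem sum_vertexPartition [Finite S] {N : Type*} [AddCommMonoid N] (g : StablePartition W → N)
    {x : τ.graph.V} {I J K L : τ.graph.F}
    (hI : τ.graph.bd I = x) (hJ : τ.graph.bd J = x) (hK : τ.graph.bd K = x)
    (hL : τ.graph.bd L = x) {i j k l : S} (hi : i ∈ τ.graph.branch I) (hj : j ∈ τ.graph.branch J)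
    (hk : k ∈ τ.graph.branch K) (hl : l ∈ τ.graph.branch L) :
    (∑ α : VertexPartition τ x, if α.Separates I J K L then g (τ.vertexPartition α) else 0) =
      ∑ σ ∈ τ.splitsᶜ, if ∃ A, σ.IsPart A ∧ τ.BreaksAt x A ∧ i ∈ A ∧ j ∈ A ∧ k ∉ A ∧ l ∉ A
        then g σ else 0 := by
  rw [← Finset.sum_filter, ← Finset.sum_filter]
  have sep : ∀ α : VertexPartition τ x, α.Separates I J K L ↔
      i ∈ α.labels ∧ j ∈ α.labels ∧ k ∉ α.labels ∧ l ∉ α.labels := fun α => by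
    rw [α.mem_part_iff hI hi, α.mem_part_iff hJ hj, α.mem_part_iff hK hk, α.mem_part_iff hL hl,
      VertexPartition.Separates]
  refine Finset.sum_bij (fun α _ => τ.vertexPartition α) ?_ ?_ ?_ fun _ _ => rfl
  · intro α hα
    rw [Finset.mem_filter, sep] at hα
    rw [Finset.mem_filter]
    exact ⟨Finset.mem_compl.2 α.notMem_splits, _, α.isPart_labels, breaksAt_labels α, hα.2⟩
  · intro α hα β hβ e
    rw [Finset.mem_filter, sep] at hα hβ
    have h1 := α.isPart_labels
    rw [e] at h1
    rcases h1.eq_or β.isPart_labels with h | h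
    · exact VertexPartition.ext_of_labels h.symm
    · exact absurd hα.2.1 (h ▸ hβ.2.1 : i ∈ α.labelsᶜ)
  · intro σ hσ
    obtain ⟨hn, A, hA, hx, h⟩ := Finset.mem_filter.1 hσ
    obtain ⟨α, rfl, h2⟩ := exists_vertexPartition hA (Finset.mem_compl.1 hn) hx
    exact ⟨α, Finset.mem_filter.2 ⟨Finset.mem_univ _, (sep α).2 h⟩, h2⟩

end PSTree

/-! ### Linear forms near a vertex and near an edge -/

theorem sign_of_separates {k : Type v} [CommRing k] {σ : StablePartition W} {a b c d : S}
    (h : Allowed W a b c d) (hs : σ.Separates a b c d) : sign k σ a b c d = 1 := if_pos ⟨h, hs⟩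

theorem not_separates_swap {σ : StablePartition W} {a b c d : S} (hs : σ.Separates a b c d) :
    ¬ σ.Separates c b a d := by
  obtain ⟨A, hA⟩ := σ.exists_isPart
  rw [hA.separates_iff] at hs ⊢
  tauto

theorem sign_of_separates_swap {k : Type v} [CommRing k] {σ : StablePartition W} {a b c d : S}
    (h : Allowed W a b c d) (hs : σ.Separates c b a d) : sign k σ a b c d = -1 := by
  rw [sign, if_neg fun h' => not_separates_swap hs h'.2, if_pos ⟨h, hs⟩]

theorem sign_eq_zero {k : Type v} [CommRing k] {σ : StablePartition W} {a b c d : S}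
    (h1 : ¬ σ.Separates a b c d) (h2 : ¬ σ.Separates c b a d) : sign k σ a b c d = 0 := by
  rw [sign, if_neg fun h' => h1 h'.2, if_neg fun h' => h2 h'.2]

theorem Allowed.rotate {a b c d : S} (h : Allowed W a b c d) : Allowed W c d a b := by
  obtain ⟨h1, h2, h3, h4, h5⟩ := h
  refine ⟨?_, h3, h2, h5, h4⟩
  simp only [List.nodup_cons, List.mem_cons, List.not_mem_nil, or_false, not_or, not_false_eq_true,
    List.nodup_nil, and_true] at h1 ⊢
  tauto

namespace PSTree

variable {τ : PSTree W}

/-- An edge does not separate two flags at a vertex from two other ones. -/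
theorem not_separates_of_mem_splits {σ : StablePartition W} (hσ : σ ∈ τ.splits)
    {I J K L : τ.graph.F} (hJ : τ.graph.bd J = τ.graph.bd I) (hK : τ.graph.bd K = τ.graph.bd I)
    (hL : τ.graph.bd L = τ.graph.bd I) (hIJ : I ≠ J) (hKL : K ≠ L) {i j k l : S}
    (hi : i ∈ τ.graph.branch I) (hj : j ∈ τ.graph.branch J) (hk : k ∈ τ.graph.branch K)
    (hl : l ∈ τ.graph.branch L) : ¬ σ.Separates i j k l := by
  have hG := τ.stable.tree
  obtain ⟨f, hf, hσf⟩ := mem_splits.1 hσ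
  obtain ⟨p, hp, h⟩ := hG.exists_subset_or hf (τ.graph.bd I)
  have key : ∀ {A : Set S}, A ⊆ τ.graph.branch p → ¬ (i ∈ A ∧ j ∈ A) ∧ ¬ (k ∈ A ∧ l ∈ A) :=
    fun hA => ⟨fun h => hIJ ((hG.flag_unique hp (hA h.1) hi).symm.trans
      (hG.flag_unique (hp.trans hJ.symm) (hA h.2) hj)),
      fun h => hKL ((hG.flag_unique (hp.trans hK.symm) (hA h.1) hk).symm.trans
      (hG.flag_unique (hp.trans hL.symm) (hA h.2) hl))⟩
  rw [hσf.separates_iff]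
  rcases h with h | h
  · have := key h
    tauto
  · have := key h
    simp only [Set.mem_compl_iff] at this
    tauto

open Classical in
theorem branch_subset_or_of_isFace {σ : StablePartition W} {A : Set S} (hσ : σ.IsPart A)
    (hF : IsFace (Insert.insert σ τ.splits)) {f : τ.graph.F} (h1 : ¬ A ⊆ τ.graph.branch f)
    (h2 : ¬ Aᶜ ⊆ τ.graph.branch f) : τ.graph.branch f ⊆ A ∨ τ.graph.branch f ⊆ Aᶜ := by
  by_cases hf : τ.graph.inv f = f
  · obtain ⟨s, rfl⟩ := exists_label hf
    rw [branch_label, Set.singleton_subset_iff, Set.singleton_subset_iff]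
    exact Classical.em _
  · rcases nested_of_isFace_insert hσ hF hf with h | h | h | h
    · exact Or.inl h
    · exact Or.inr h
    · exact absurd (Set.compl_subset_comm.1 h) h2
    · exact absurd (Set.compl_subset_compl.1 h) h1

open Classical in
/-- A partition compatible with `τ` that separates labels on two branches at `x` from labels on two
other ones breaks the vertex `x`. -/
theorem breaksAt_iff_separates {σ : StablePartition W} (hF : IsFace (Insert.insert σ τ.splits))
    {x : τ.graph.V} {I J K L : τ.graph.F} (hI : τ.graph.bd I = x) (hJ : τ.graph.bd J = x)
    (hK : τ.graph.bd K = x) (hL : τ.graph.bd L = x) (hIJ : I ≠ J) (hKL : K ≠ L) {i j k l : S}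
    (hi : i ∈ τ.graph.branch I) (hj : j ∈ τ.graph.branch J) (hk : k ∈ τ.graph.branch K)
    (hl : l ∈ τ.graph.branch L) :
    (∃ A, σ.IsPart A ∧ τ.BreaksAt x A ∧ i ∈ A ∧ j ∈ A ∧ k ∉ A ∧ l ∉ A) ↔
      σ.Separates i j k l := by
  have hG := τ.stable.tree
  constructor
  · rintro ⟨A, hA, -, h⟩
    exact ⟨A, hA, h⟩
  · rintro ⟨A, hA, hi', hj', hk', hl'⟩
    refine ⟨A, hA, fun f hf => branch_subset_or_of_isFace hA hF (fun h => ?_) (fun h => ?_),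
      hi', hj', hk', hl'⟩
    · exact hIJ ((hG.flag_unique (hf.trans hI.symm) (h hi') hi).symm.trans
        (hG.flag_unique (hf.trans hJ.symm) (h hj') hj))
    · exact hKL ((hG.flag_unique (hf.trans hK.symm) (h hk') hk).symm.trans
        (hG.flag_unique (hf.trans hL.symm) (h hl') hl))

variable {k : Type v} [CommRing k] {N : Type*} [AddCommGroup N] [Module k N]

open Classical in
/-- The linear relation of an allowed quadruple of labels on four distinct branches at a
vertex is the standard relation of the corresponding flags. -/
theorem sum_sign_smul [Finite S] {g : StablePartition W → N}
    (hg : ∀ σ, ¬ IsFace (Insert.insert σ τ.splits) → g σ = 0)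
    {x : τ.graph.V} {I J K L : τ.graph.F} (hI : τ.graph.bd I = x) (hJ : τ.graph.bd J = x)
    (hK : τ.graph.bd K = x) (hL : τ.graph.bd L = x) (hd : [I, J, K, L].Nodup) {a b c d : S}
    (ha : a ∈ τ.graph.branch I) (hb : b ∈ τ.graph.branch J) (hc : c ∈ τ.graph.branch K)
    (hd' : d ∈ τ.graph.branch L) (hall : Allowed W a b c d) :
    ∑ σ ∈ τ.splitsᶜ, sign k σ a b c d • g σ =
      (∑ α : VertexPartition τ x, if α.Separates I J K L then g (τ.vertexPartition α) else 0) -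
      ∑ α : VertexPartition τ x, if α.Separates K J I L then g (τ.vertexPartition α) else 0 := by
  rw [sum_vertexPartition g hI hJ hK hL ha hb hc hd',
    sum_vertexPartition g hK hJ hI hL hc hb ha hd',
    ← Finset.sum_sub_distrib]
  simp only [List.nodup_cons, List.mem_cons, List.not_mem_nil, or_false, not_or, not_false_eq_true,
    List.nodup_nil, and_true] at hd
  obtain ⟨⟨hIJ, hIK, hIL⟩, ⟨hJK, hJL⟩, hKL⟩ := hd
  refine Finset.sum_congr rfl fun σ hσ => ?_
  by_cases hF : IsFace (Insert.insert σ τ.splits)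
  swap
  · rw [hg σ hF]; simp
  rw [breaksAt_iff_separates hF hI hJ hK hL hIJ hKL ha hb hc hd',
    breaksAt_iff_separates hF hK hJ hI hL (Ne.symm hJK) hIL hc hb ha hd']
  by_cases h1 : σ.Separates a b c d
  · rw [sign_of_separates hall h1, if_pos h1, if_neg (not_separates_swap h1), one_smul, sub_zero]
  · by_cases h2 : σ.Separates c b a d
    · rw [sign_of_separates_swap hall h2, if_neg h1, if_pos h2, neg_smul, one_smul, zero_sub]
    · rw [sign_eq_zero h1 h2, if_neg h1, if_neg h2, zero_smul, sub_zero]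

/-- The flags `I, J` and `K, L` lie at the two ends of the edge of `f`, apart from `f` and its
opposite, and `a, b, c, d` are labels on their branches that form an allowed quadruple. -/
structure AroundEdge (τ : PSTree W) (f I J K L : τ.graph.F) (a b c d : S) : Prop where
  ne : τ.graph.inv f ≠ f
  bd_I : τ.graph.bd I = τ.graph.bd f
  bd_J : τ.graph.bd J = τ.graph.bd f
  bd_K : τ.graph.bd K = τ.graph.bd (τ.graph.inv f)
  bd_L : τ.graph.bd L = τ.graph.bd (τ.graph.inv f)
  I_ne : I ≠ f
  J_ne : J ≠ f
  K_ne : K ≠ τ.graph.inv f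
  L_ne : L ≠ τ.graph.inv f
  I_ne_J : I ≠ J
  K_ne_L : K ≠ L
  mem_I : a ∈ τ.graph.branch I
  mem_J : b ∈ τ.graph.branch J
  mem_K : c ∈ τ.graph.branch K
  mem_L : d ∈ τ.graph.branch L
  allowed : Allowed W a b c d

namespace AroundEdge

variable {f I J K L : τ.graph.F} {a b c d : S} (h : AroundEdge τ f I J K L a b c d)
include h

theorem flip : AroundEdge τ (τ.graph.inv f) K L I J c d a b where
  ne := inv_ne h.ne
  bd_I := h.bd_K
  bd_J := h.bd_L
  bd_K := by rw [τ.graph.inv_inv]; exact h.bd_I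
  bd_L := by rw [τ.graph.inv_inv]; exact h.bd_J
  I_ne := h.K_ne
  J_ne := h.L_ne
  K_ne := by rw [τ.graph.inv_inv]; exact h.I_ne
  L_ne := by rw [τ.graph.inv_inv]; exact h.J_ne
  I_ne_J := h.K_ne_L
  K_ne_L := h.I_ne_J
  mem_I := h.mem_K
  mem_J := h.mem_L
  mem_K := h.mem_I
  mem_L := h.mem_J
  allowed := h.allowed.rotate

theorem a_notMem : a ∉ τ.graph.branch f := τ.subset_compl_branch h.bd_I h.I_ne h.mem_I

theorem b_notMem : b ∉ τ.graph.branch f := τ.subset_compl_branch h.bd_J h.J_ne h.mem_J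

theorem c_mem : c ∈ τ.graph.branch f := by
  have := h.flip.a_notMem
  rwa [τ.stable.tree.branch_inv h.ne, Set.mem_compl_iff, not_not] at this

theorem d_mem : d ∈ τ.graph.branch f := by
  have := h.flip.b_notMem
  rwa [τ.stable.tree.branch_inv h.ne, Set.mem_compl_iff, not_not] at this

theorem separates {σ : StablePartition W} (hσ : σ.IsPart (τ.graph.branch f)) :
    σ.Separates a b c d :=
  hσ.separates_iff.2 (Or.inr ⟨h.a_notMem, h.b_notMem, h.c_mem, h.d_mem⟩)

open Classical in
theorem breaksAt_of_subset {σ : StablePartition W} {A : Set S}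
    (hσ : σ.IsPart A) (hF : IsFace (Insert.insert σ τ.splits))
    (ha : a ∈ A) (hb : b ∈ A) (hA : A ⊆ (τ.graph.branch f)ᶜ) : τ.BreaksAt (τ.graph.bd f) A := by
  have hG := τ.stable.tree
  intro g hg
  by_cases hgf : g = f
  · subst hgf
    exact Or.inr (Set.subset_compl_comm.1 hA)
  refine branch_subset_or_of_isFace hσ hF (fun h' => ?_) (fun h' => ?_)
  · exact h.I_ne_J ((hG.flag_unique (hg.trans h.bd_I.symm) (h' ha) h.mem_I).symm.trans
        (hG.flag_unique (hg.trans h.bd_J.symm) (h' hb) h.mem_J))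
  · exact hgf (hG.flag_unique hg (h' fun hc => hA hc h.c_mem) h.c_mem)

theorem subset_of_breaksAt {A : Set S} (hA : τ.BreaksAt (τ.graph.bd f) A) (hc : c ∉ A) :
    A ⊆ (τ.graph.branch f)ᶜ :=
  Set.subset_compl_comm.1 ((hA f rfl).resolve_left fun h' => hc (h' h.c_mem))

open Classical in
theorem breaksAt_iff {σ : StablePartition W} (hF : IsFace (Insert.insert σ τ.splits))
    {A : Set S} (hσ : σ.IsPart A) (ha : a ∈ A) (hb : b ∈ A) (hc : c ∉ A) :
    (∃ A, σ.IsPart A ∧ τ.BreaksAt (τ.graph.bd f) A ∧ a ∈ A ∧ b ∈ A ∧ c ∉ A ∧ d ∉ A) ↔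
      d ∉ A ∧ A ⊆ (τ.graph.branch f)ᶜ := by
  constructor
  · rintro ⟨B, hB, hx, h1, h2, h3, h4⟩
    rcases hσ.eq_or hB with rfl | rfl
    · exact ⟨h4, h.subset_of_breaksAt hx hc⟩
    · exact absurd ha h1
  · rintro ⟨hd, hA⟩
    exact ⟨A, hσ, h.breaksAt_of_subset hσ hF ha hb hA, ha, hb, hc, hd⟩

open Classical in
theorem subset_or_subset {σ : StablePartition W} (hF : IsFace (Insert.insert σ τ.splits))
    {A : Set S} (hσ : σ.IsPart A) (ha : a ∈ A) (hc : c ∉ A) :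
    A ⊆ (τ.graph.branch f)ᶜ ∨ (τ.graph.branch f)ᶜ ⊆ A := by
  rcases nested_of_isFace_insert hσ hF h.ne with h' | h' | h' | h'
  · exact absurd (h' h.c_mem) hc
  · exact Or.inl (Set.subset_compl_comm.1 h')
  · exact Or.inr h'
  · exact absurd ha (h' h.a_notMem)

/-- A partition which does not cross the edge of `f` cannot pair the labels across this edge. -/
theorem not_separates_swap {σ : StablePartition W} {σ' : StablePartition W}
    (hσ : σ.IsPart (τ.graph.branch f)) (hc : ¬ σ.Cross σ') : ¬ σ'.Separates c b a d :=
  fun h' => hc ⟨a, b, c, d, h.allowed, h.separates hσ, h'⟩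

open Classical in
/-- The partitions which occur in the linear relation of a quadruple around an edge, apart from that
edge itself, break one of the two ends of the edge. -/
theorem sum_sign_smul [Finite S] {g : StablePartition W → N}
    (hg : ∀ σ, ¬ IsFace (Insert.insert σ τ.splits) → g σ = 0) :
    ∑ σ ∈ τ.splitsᶜ, sign k σ a b c d • g σ =
      (∑ α : VertexPartition τ (τ.graph.bd f), if α.Separates I J f f
        then g (τ.vertexPartition α) else 0) +
      ∑ α : VertexPartition τ (τ.graph.bd (τ.graph.inv f)),
        if α.Separates K L (τ.graph.inv f) (τ.graph.inv f)
        then g (τ.vertexPartition α) else 0 := by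
  have h' := h.flip
  have hinv := τ.stable.tree.branch_inv h.ne
  rw [sum_vertexPartition g h.bd_I h.bd_J rfl rfl h.mem_I h.mem_J h.c_mem h.d_mem,
    sum_vertexPartition g h'.bd_I h'.bd_J rfl rfl h'.mem_I h'.mem_J h'.c_mem h'.d_mem,
    ← Finset.sum_add_distrib]
  refine Finset.sum_congr rfl fun σ hσ => ?_
  by_cases hF : IsFace (Insert.insert σ τ.splits)
  swap
  · rw [hg σ hF]; simp
  have hswap : ¬ σ.Separates c b a d := h.not_separates_swap (edgePartition_isPart h.ne)
    (hF _ (Finset.mem_insert_of_mem (mem_splits.2 ⟨f, h.ne, edgePartition_isPart h.ne⟩)) _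
      (Finset.mem_insert_self _ _))
  by_cases hs : σ.Separates a b c d
  · obtain ⟨A, hA, ha, hb, hc, hd⟩ := hs
    have hne : A ≠ (τ.graph.branch f)ᶜ := by
      rintro rfl
      refine Finset.mem_compl.1 hσ (mem_splits.2 ⟨f, h.ne, ?_⟩)
      have := IsPart.compl hA
      rwa [compl_compl] at this
    rw [sign_of_separates h.allowed ⟨A, hA, ha, hb, hc, hd⟩, one_smul,
      h.breaksAt_iff hF hA ha hb hc,
      h'.breaksAt_iff hF (IsPart.compl hA) hc hd (fun h => h ha), hinv, compl_compl,
      Set.compl_subset_comm]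
    rcases h.subset_or_subset hF hA ha hc with h1 | h1
    · rw [if_pos ⟨hd, h1⟩, if_neg fun h2 => hne (h1.antisymm h2.2), add_zero]
    · rw [if_neg fun h2 => hne (h2.2.antisymm h1), if_pos ⟨fun h => h hb, h1⟩, zero_add]
  · rw [sign_eq_zero hs hswap, if_neg, if_neg, zero_smul, add_zero]
    · rintro ⟨A, hA, -, h1, h2, h3, h4⟩
      exact hs ⟨Aᶜ, IsPart.compl hA, h3, h4, fun h => h h1, fun h => h h2⟩
    · rintro ⟨A, hA, -, h1⟩
      exact hs ⟨A, hA, h1⟩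

theorem sign_eq_one {σ : StablePartition W} (hσ : σ.IsPart (τ.graph.branch f)) :
    sign k σ a b c d = 1 := sign_of_separates h.allowed (h.separates hσ)

/-- Together with `sign_eq_one`: the linear form of a quadruple around an edge is dual to
this edge among all edges of the tree. -/
theorem sign_eq_zero_of_ne {σ σ' : StablePartition W} (hσ : σ.IsPart (τ.graph.branch f))
    (hσ' : σ' ∈ τ.splits) (hne : σ' ≠ σ) : sign k σ' a b c d = 0 := by
  classical
  have hσs : σ ∈ τ.splits := mem_splits.2 ⟨f, h.ne, hσ⟩
  refine sign_eq_zero ?_ (h.not_separates_swap hσ (isFace_splits _ hσs _ hσ'))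
  rintro ⟨A, hA, ha, hb, hc, hd⟩
  have hF : IsFace (Insert.insert σ' τ.splits) := by
    rw [Finset.insert_eq_of_mem hσ']; exact isFace_splits
  -- a part of `σ'` inside the side of the edge which carries `a, b` is all of this side, because
  -- the other part, being contained in one branch, can only lie in the branch of the edge
  have key : ∀ {f : τ.graph.F} {I J K L : τ.graph.F} {a b c d : S} {A : Set S},
      AroundEdge τ f I J K L a b c d → σ'.IsPart A → a ∈ A → b ∈ A →
      A ⊆ (τ.graph.branch f)ᶜ → (τ.graph.branch f)ᶜ ⊆ A := by
    intro f I J K L a b c d A h hA ha hb hs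
    obtain ⟨p, hp, hp'⟩ := mem_splits.1 hσ'
    obtain ⟨q, hq, hq'⟩ := τ.stable.tree.exists_subset_or hp (τ.graph.bd f)
    have hq'' : A ⊆ τ.graph.branch q ∨ Aᶜ ⊆ τ.graph.branch q := by
      rcases hA.eq_or hp' with e | e
      · rwa [e] at hq'
      · rw [e, compl_compl] at hq'; exact hq'.symm
    rcases hq'' with h1 | h1
    · exact absurd ((τ.stable.tree.flag_unique (hq.trans h.bd_I.symm) (h1 ha) h.mem_I).symm.trans
        (τ.stable.tree.flag_unique (hq.trans h.bd_J.symm) (h1 hb) h.mem_J)) h.I_ne_J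
    · have : q = f := τ.stable.tree.flag_unique hq (h1 fun hc => hs hc h.c_mem) h.c_mem
      subst this
      exact Set.compl_subset_comm.1 h1
  have e : (τ.graph.branch f)ᶜ = A := by
    rcases h.subset_or_subset hF hA ha hc with h1 | h1
    · exact (key h hA ha hb h1).antisymm h1
    · have hinv := τ.stable.tree.branch_inv h.ne
      have := key h.flip (IsPart.compl hA) hc hd (by rw [hinv]; exact Set.compl_subset_compl.2 h1)
      rw [hinv] at this
      exact h1.antisymm (Set.compl_subset_compl.1 this)
  exact hne ((e ▸ hA : σ'.IsPart _).ext hσ.compl)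

end AroundEdge

/-- At the start of a half-edge there are two further flags, one of them with a white label on its
branch. -/
theorem exists_white_pair {f : τ.graph.F} (hf : τ.graph.inv f ≠ f) :
    ∃ I J a b, τ.graph.bd I = τ.graph.bd f ∧ τ.graph.bd J = τ.graph.bd f ∧ I ≠ f ∧ J ≠ f ∧ I ≠ J ∧
      a ∈ τ.graph.branch I ∧ a ∈ W ∧ b ∈ τ.graph.branch J := by
  obtain ⟨a, ha, haW⟩ := (τ.stablePart_branch _ (inv_ne hf)).2
  obtain ⟨I, hI, haI⟩ := τ.stable.tree.exists_flag (τ.graph.bd f) a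
  have hIf : I ≠ f := by
    rintro rfl
    rw [τ.stable.tree.branch_inv hf] at ha
    exact ha haI
  obtain ⟨J, h1, h2, h3⟩ := τ.exists_third f I
  obtain ⟨b, hb⟩ := τ.branch_nonempty J
  exact ⟨I, J, a, b, hI, h1, hIf, h2, h3.symm, haI, haW, hb⟩

theorem exists_aroundEdge {f : τ.graph.F} (hf : τ.graph.inv f ≠ f) :
    ∃ I J K L a b c d, AroundEdge τ f I J K L a b c d := by
  obtain ⟨I, J, a, b, h1, h2, h3, h4, h5, h6, h7, h8⟩ := exists_white_pair hf
  obtain ⟨K, L, c, d, g1, g2, g3, g4, g5, g6, g7, g8⟩ := exists_white_pair (inv_ne hf)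
  have hG := τ.stable.tree
  have out : ∀ {P Q : τ.graph.F} {s t : S}, τ.graph.bd P = τ.graph.bd f → P ≠ f →
      s ∈ τ.graph.branch P → τ.graph.bd Q = τ.graph.bd (τ.graph.inv f) → Q ≠ τ.graph.inv f →
      t ∈ τ.graph.branch Q → s ≠ t := by
    rintro P Q s t hP hPf hs hQ hQf ht rfl
    have := τ.subset_compl_branch hQ hQf ht
    rw [hG.branch_inv hf, compl_compl] at this
    exact τ.subset_compl_branch hP hPf hs this
  have same : ∀ {P Q : τ.graph.F} {s t : S}, τ.graph.bd P = τ.graph.bd Q → P ≠ Q →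
      s ∈ τ.graph.branch P → t ∈ τ.graph.branch Q → s ≠ t := by
    rintro P Q s t h hne hs ht rfl
    exact hne (hG.flag_unique h hs ht)
  refine ⟨I, J, K, L, a, b, c, d, hf, h1, h2, g1, g2, h3, h4, g3, g4, h5, g5, h6, h8, g6, g8,
    ⟨?_, Or.inl h7, Or.inl g7, Or.inl g7, Or.inl h7⟩⟩
  simp [same (h1.trans h2.symm) h5 h6 h8, same (g1.trans g2.symm) g5 g6 g8,
    out h1 h3 h6 g1 g3 g6, out h1 h3 h6 g2 g4 g8, out h2 h4 h8 g1 g3 g6, out h2 h4 h8 g2 g4 g8]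

end PSTree

open PSTree

/-! ### Dual linear forms -/

/-- The linear forms among the generators of the ideal of relations. -/
noncomputable def signForms (k : Type v) [CommRing k] (W : Set S) :
    Submodule k (StablePartition W → k) :=
  Submodule.span k {m | ∃ a b c d : S, m = fun σ => sign k σ a b c d}

/-- The dual form of an edge is the linear relation of an allowed quadruple around it. -/
theorem hasDuals [Finite S] (h3 : 3 ≤ Nat.card S) (hW : W.Nonempty) (k : Type v) [CommRing k] :
    HasDuals IsFace (signForms k W) := by
  intro F hF σ hσ
  obtain ⟨τ, rfl⟩ := exists_splits_eq h3 hW F hF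
  obtain ⟨f, hf, hσf⟩ := mem_splits.1 hσ
  obtain ⟨I, J, K, L, a, b, c, d, h⟩ := exists_aroundEdge hf
  exact ⟨_, Submodule.subset_span ⟨a, b, c, d, rfl⟩, h.sign_eq_one hσf,
    fun σ' hσ' hne => h.sign_eq_zero_of_ne hσf hσ' hne⟩

/-! ### Linear forms of a pair of labels -/

variable {k : Type v} [CommRing k]

open Classical in
/-- The indicator function of the partitions such that `i, j` lie in the part that does not contain
`r`. It is zero if `i` or `j` is equal to `r`. -/
noncomputable def rootForm (k : Type v) [CommRing k] (r i j : S) (σ : StablePartition W) : k :=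
  if σ.Separates i j r r then 1 else 0

theorem separates_root_iff {σ : StablePartition W} {A : Set S} (hA : σ.IsPart A) {r : S}
    (hr : r ∉ A) {i j : S} : σ.Separates i j r r ↔ i ∈ A ∧ j ∈ A := by
  rw [hA.separates_iff]
  tauto

theorem rootForm_comm (r i j : S) : rootForm (W := W) k r i j = rootForm k r j i := by
  classical
  funext σ
  obtain ⟨A, hA, hr⟩ := σ.exists_isPart_notMem r
  simp only [rootForm, separates_root_iff hA hr, and_comm]

theorem rootForm_root (r j : S) : rootForm (W := W) k r r j = 0 := by
  funext σ
  obtain ⟨A, hA, hr⟩ := σ.exists_isPart_notMem r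
  simp [rootForm, separates_root_iff hA hr, hr]

theorem sign_eq_rootForm (r : S) {a b c d : S} (h : Allowed W a b c d) :
    (fun σ : StablePartition W => sign k σ a b c d) =
      rootForm k r a b + rootForm k r c d - rootForm k r c b - rootForm k r a d := by
  classical
  funext σ
  obtain ⟨A, hA, hr⟩ := σ.exists_isPart_notMem r
  simp only [sign, rootForm, separates_root_iff hA hr, hA.separates_iff, h, true_and,
    Pi.add_apply, Pi.sub_apply]
  by_cases ha : a ∈ A <;> by_cases hb : b ∈ A <;> by_cases hc : c ∈ A <;> by_cases hd : d ∈ A <;>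
    simp [ha, hb, hc, hd]

/-- Pairs of distinct labels different from `r`, the first of which is white. -/
def RootPair (W : Set S) (r : S) : Type u :=
  {p : S × S // p.1 ∈ W ∧ p.1 ≠ p.2 ∧ p.1 ≠ r ∧ p.2 ≠ r}

noncomputable instance [Finite S] (r : S) : Fintype (RootPair W r) :=
  have : Finite (RootPair W r) := Subtype.finite
  Fintype.ofFinite _

/-- The linear form of a pair. -/
noncomputable def RootPair.form {r : S} (k : Type v) [CommRing k] (p : RootPair W r) :
    StablePartition W → k := rootForm k r p.1.1 p.1.2

variable (W k) in
/-- A combination of the forms of pairs whose coefficients have sum zero. -/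
def Balanced [Finite S] (r : S) (m : StablePartition W → k) : Prop :=
  ∃ c : RootPair W r → k, ∑ p, c p = 0 ∧ m = ∑ p, c p • p.form k

theorem Balanced.zero [Finite S] (r : S) : Balanced W k r 0 := ⟨0, by simp, by simp⟩

theorem Balanced.add [Finite S] {r : S} {m m' : StablePartition W → k} (h : Balanced W k r m)
    (h' : Balanced W k r m') : Balanced W k r (m + m') := by
  obtain ⟨c, h1, rfl⟩ := h
  obtain ⟨c', h1', rfl⟩ := h'
  exact ⟨c + c', by simp [Finset.sum_add_distrib, h1, h1'], by
    simp [add_smul, Finset.sum_add_distrib]⟩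

theorem Balanced.smul [Finite S] {r : S} {m : StablePartition W → k} (a : k)
    (h : Balanced W k r m) : Balanced W k r (a • m) := by
  obtain ⟨c, h1, rfl⟩ := h
  exact ⟨a • c, by simp [← Finset.mul_sum, h1], by
    simp [Finset.smul_sum, mul_smul]⟩

theorem balanced_sub [Finite S] {r : S} (p q : RootPair W r) :
    Balanced W k r (p.form k - q.form k) := by
  classical
  refine ⟨Pi.single p 1 - Pi.single q 1, by simp, ?_⟩
  simp [sub_smul, Finset.sum_sub_distrib, Pi.single_apply]

theorem exists_rootPair {r i j : S} (h : i ∈ W ∨ j ∈ W) (hij : i ≠ j) (hi : i ≠ r) (hj : j ≠ r) :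
    ∃ p : RootPair W r, rootForm k r i j = p.form k := by
  rcases h with h | h
  · exact ⟨⟨(i, j), h, hij, hi, hj⟩, rfl⟩
  · exact ⟨⟨(j, i), h, hij.symm, hj, hi⟩, rootForm_comm r i j⟩

theorem balanced_sign [Finite S] (r a b c d : S) :
    Balanced W k r (fun σ => sign k σ a b c d) := by
  by_cases h : Allowed W a b c d
  swap
  · convert Balanced.zero (W := W) (k := k) r using 1
    funext σ
    simp [sign, h]
  rw [sign_eq_rootForm r h]
  have hd := h.distinct
  simp only [List.nodup_cons, List.mem_cons, List.not_mem_nil, or_false, not_or, not_false_eq_true,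
    List.nodup_nil, and_true] at hd
  obtain ⟨⟨hab : a ≠ b, hac : a ≠ c, had : a ≠ d⟩, ⟨hbc : b ≠ c, hbd : b ≠ d⟩, hcd : c ≠ d⟩ := hd
  have pab := exists_rootPair (k := k) (r := r) h.left_ij hab
  have pcd := exists_rootPair (k := k) (r := r) h.left_kl hcd
  have pcb := exists_rootPair (k := k) (r := r) h.right_kj hbc.symm
  have pad := exists_rootPair (k := k) (r := r) h.right_il had
  by_cases ha : a = r
  · subst ha
    obtain ⟨p, hp⟩ := pcd hac.symm had.symm
    obtain ⟨q, hq⟩ := pcb hac.symm hab.symm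
    rw [rootForm_root, rootForm_root, zero_add, sub_zero, hp, hq]
    exact balanced_sub p q
  by_cases hb : b = r
  · subst hb
    obtain ⟨p, hp⟩ := pcd hbc.symm hbd.symm
    obtain ⟨q, hq⟩ := pad hab hbd.symm
    rw [rootForm_comm _ a, rootForm_comm _ c b, rootForm_root, rootForm_root, zero_add, sub_zero,
      hp, hq]
    exact balanced_sub p q
  by_cases hc : c = r
  · subst hc
    obtain ⟨p, hp⟩ := pab hac hbc
    obtain ⟨q, hq⟩ := pad hac hcd.symm
    rw [rootForm_root, rootForm_root, add_zero, sub_zero, hp, hq]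
    exact balanced_sub p q
  by_cases hd : d = r
  · subst hd
    obtain ⟨p, hp⟩ := pab had hbd
    obtain ⟨q, hq⟩ := pcb hcd hbd
    rw [rootForm_comm _ c d, rootForm_comm _ a d, rootForm_root, rootForm_root, add_zero, sub_zero,
      hp, hq]
    exact balanced_sub p q
  obtain ⟨p, hp⟩ := pab ha hb
  obtain ⟨q, hq⟩ := pcd hc hd
  obtain ⟨s, hs⟩ := pcb hc hb
  obtain ⟨t, ht⟩ := pad ha hd
  rw [hp, hq, hs, ht, show p.form k + q.form k - s.form k - t.form k =
    (p.form k - s.form k) + (q.form k - t.form k) by abel]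
  exact (balanced_sub p s).add (balanced_sub q t)

theorem balanced_of_mem_signForms [Finite S] (r : S) {m : StablePartition W → k}
    (hm : m ∈ signForms k W) : Balanced W k r m := by
  induction hm using Submodule.span_induction with
  | mem m h => obtain ⟨a, b, c, d, rfl⟩ := h; exact balanced_sign r a b c d
  | zero => exact .zero r
  | add m m' _ _ h h' => exact h.add h'
  | smul a m _ h => exact h.smul a

/-! ### The median vertex of a pair and the root -/

namespace PSTree

variable {τ : PSTree W}

variable (τ) in
/-- The branches at `x` that contain `i`, `j` and `r` are distinct. -/
def Median (r i j : S) (x : τ.graph.V) : Prop :=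
  ∃ I J R, τ.graph.bd I = x ∧ τ.graph.bd J = x ∧ τ.graph.bd R = x ∧ I ≠ J ∧ I ≠ R ∧ J ≠ R ∧
    i ∈ τ.graph.branch I ∧ j ∈ τ.graph.branch J ∧ r ∈ τ.graph.branch R

/-- The median vertex: among the branches that contain `r`, but neither `i` nor `j`, a
largest one starts there. -/
theorem exists_median [Finite S] {r i j : S} (hij : i ≠ j) (hi : i ≠ r) (hj : j ≠ r) :
    ∃ x, τ.Median r i j x := by
  have hG := τ.stable.tree
  have := τ.graph.finite_F
  obtain ⟨R, ⟨hRr, hRi, hRj⟩, hmin⟩ := Set.exists_min_image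
    {R | r ∈ τ.graph.branch R ∧ i ∉ τ.graph.branch R ∧ j ∉ τ.graph.branch R}
    (fun R => ((τ.graph.branch R)ᶜ).ncard) (Set.toFinite _)
    ⟨τ.graph.label r, by simp [branch_label, hi, hj]⟩
  obtain ⟨I, hI, hiI⟩ := hG.exists_flag (τ.graph.bd R) i
  obtain ⟨J, hJ, hjJ⟩ := hG.exists_flag (τ.graph.bd R) j
  have hIR : I ≠ R := by rintro rfl; exact hRi hiI
  have hJR : J ≠ R := by rintro rfl; exact hRj hjJ
  refine ⟨_, I, J, R, hI, hJ, rfl, ?_, hIR, hJR, hiI, hjJ, hRr⟩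
  rintro rfl
  have hIe : τ.graph.inv I ≠ I := by
    intro h
    obtain ⟨s, rfl⟩ := exists_label h
    rw [branch_label] at hiI hjJ
    exact hij (hiI.trans hjJ.symm)
  have hb := hG.branch_inv hIe
  have hsub := τ.subset_compl_branch hI hIR
  have hlt : ((τ.graph.branch (τ.graph.inv I))ᶜ).ncard < ((τ.graph.branch R)ᶜ).ncard := by
    rw [hb, compl_compl]
    refine Set.ncard_lt_ncard (hsub.ssubset_of_ne fun e => ?_) (Set.toFinite _)
    obtain ⟨s, h1, h2⟩ := τ.exists_notMem_branches hI
    exact h1 (e ▸ h2)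
  refine absurd (hmin (τ.graph.inv I) ⟨?_, ?_, ?_⟩) (not_le.2 hlt)
  · rw [hb]; exact fun h => hsub h hRr
  · rw [hb]; exact fun h => h hiI
  · rw [hb]; exact fun h => h hjJ

variable {N : Type*} [AddCommGroup N] [Module k N]

open Classical in
theorem mem_of_mem_branch {σ : StablePartition W} (hF : IsFace (Insert.insert σ τ.splits))
    {A : Set S} (hA : σ.IsPart A) {I : τ.graph.F} {r i i' j : S} (hr : r ∉ A)
    (hi : i ∈ τ.graph.branch I) (hi' : i' ∈ τ.graph.branch I) (hj : j ∉ τ.graph.branch I)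
    (hrI : r ∉ τ.graph.branch I) (hiA : i ∈ A) (hjA : j ∈ A) : i' ∈ A := by
  rcases branch_subset_or_of_isFace hA hF (f := I) (fun h => hj (h hjA)) (fun h => hrI (h hr))
    with h | h
  · exact h hi'
  · exact absurd hiA (h hi)

section

variable {g : StablePartition W → N}

open Classical in
/-- On the partitions compatible with `τ`, the form of a pair with median vertex `x` depends only on
the branches at `x` in which its labels lie. -/
theorem sum_rootForm_congr [Finite S] (hg : ∀ σ, ¬ IsFace (Insert.insert σ τ.splits) → g σ = 0)
    {I J R : τ.graph.F} {r i i' j j' : S} (hI : τ.graph.bd I = τ.graph.bd R)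
    (hJ : τ.graph.bd J = τ.graph.bd R) (hIJ : I ≠ J) (hIR : I ≠ R) (hJR : J ≠ R)
    (hi : i ∈ τ.graph.branch I) (hi' : i' ∈ τ.graph.branch I) (hj : j ∈ τ.graph.branch J)
    (hj' : j' ∈ τ.graph.branch J) (hr : r ∈ τ.graph.branch R) :
    ∑ σ ∈ τ.splitsᶜ, rootForm k r i j σ • g σ = ∑ σ ∈ τ.splitsᶜ, rootForm k r i' j' σ • g σ := by
  refine Finset.sum_congr rfl fun σ _ => ?_
  by_cases hF : IsFace (Insert.insert σ τ.splits)
  swap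
  · rw [hg σ hF, smul_zero, smul_zero]
  obtain ⟨A, hA, hrA⟩ := σ.exists_isPart_notMem r
  have hJI := hJ.trans hI.symm
  have key : ∀ {i i' j j'}, i ∈ τ.graph.branch I → i' ∈ τ.graph.branch I →
      j ∈ τ.graph.branch J → j' ∈ τ.graph.branch J → i ∈ A ∧ j ∈ A → i' ∈ A ∧ j' ∈ A := by
    rintro i i' j j' hi hi' hj hj' ⟨hiA, hjA⟩
    exact ⟨mem_of_mem_branch hF hA hrA hi hi' (τ.subset_compl_branch hJI hIJ.symm hj)
      (τ.subset_compl_branch hI.symm hIR.symm hr) hiA hjA,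
      mem_of_mem_branch hF hA hrA hj hj' (τ.subset_compl_branch hJI.symm hIJ hi)
      (τ.subset_compl_branch hJ.symm hJR.symm hr) hjA hiA⟩
  have : σ.Separates i j r r ↔ σ.Separates i' j' r r := by
    rw [separates_root_iff hA hrA, separates_root_iff hA hrA]
    exact ⟨key hi hi' hj hj', key hi' hi hj' hj⟩
  simp only [rootForm, this]

variable (τ g) in
open Classical in
/-- The function `g`, extended to trees `τ(α)` by `g(σ_α)`, satisfies the standard relations at all
vertices of `τ`. -/
def StandardRelationsHold : Prop :=
  ∀ (x : τ.graph.V) (I J K L : τ.graph.F), (∀ f ∈ [I, J, K, L], τ.graph.bd f = x) →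
    [I, J, K, L].Nodup → AllowedFlags τ I J K L →
    (∑ α : VertexPartition τ x, if α.Separates I J K L then g (τ.vertexPartition α) else 0) =
      ∑ α : VertexPartition τ x, if α.Separates K J I L then g (τ.vertexPartition α) else 0

open Classical in
/-- Two pairs with the same white label and the same median vertex, compared by the standard
relation of `J, I, L, R`. Allowedness uses that `i` and `r` are white. -/
theorem sum_rootForm_of_common [Finite S]
    (hg : ∀ σ, ¬ IsFace (Insert.insert σ τ.splits) → g σ = 0) (hs : StandardRelationsHold τ g)
    {I J L R : τ.graph.F} {r i j l : S} (hI : τ.graph.bd I = τ.graph.bd R)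
    (hJ : τ.graph.bd J = τ.graph.bd R) (hL : τ.graph.bd L = τ.graph.bd R)
    (hIJ : I ≠ J) (hIL : I ≠ L) (hIR : I ≠ R) (hJR : J ≠ R) (hLR : L ≠ R)
    (hi : i ∈ τ.graph.branch I) (hj : j ∈ τ.graph.branch J) (hl : l ∈ τ.graph.branch L)
    (hr : r ∈ τ.graph.branch R) (hiW : i ∈ W) (hrW : r ∈ W) :
    ∑ σ ∈ τ.splitsᶜ, rootForm k r i j σ • g σ = ∑ σ ∈ τ.splitsᶜ, rootForm k r i l σ • g σ := by
  by_cases hJL : J = L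
  · subst hJL
    exact sum_rootForm_congr hg hI hJ hIJ hIR hJR hi hi hj hl hr
  have ne : ∀ {P Q : τ.graph.F} {s t : S}, τ.graph.bd P = τ.graph.bd R →
      τ.graph.bd Q = τ.graph.bd R → P ≠ Q → s ∈ τ.graph.branch P → t ∈ τ.graph.branch Q →
      s ≠ t := by
    rintro P Q s t hP hQ hne hs ht rfl
    exact hne (τ.stable.tree.flag_unique (hP.trans hQ.symm) hs ht)
  have hall : Allowed W j i l r := by
    refine ⟨?_, Or.inr hiW, Or.inr hrW, Or.inr hiW, Or.inr hrW⟩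
    simp [ne hJ hI hIJ.symm hj hi, ne hJ hL hJL hj hl, ne hJ rfl hJR hj hr, ne hI hL hIL hi hl,
      ne hI rfl hIR hi hr, ne hL rfl hLR hl hr]
  have hnd : [J, I, L, R].Nodup := by
    simp [hIJ.symm, hJL, hJR, hIL, hIR, hLR]
  have h := sum_sign_smul (k := k) hg hJ hI hL rfl hnd hj hi hl hr hall
  rw [hs _ J I L R (by simp [hI, hJ, hL]) hnd ⟨j, hj, i, hi, l, hl, r, hr, hall⟩, sub_self] at h
  have e : ∀ σ : StablePartition W, sign k σ j i l r = rootForm k r i j σ - rootForm k r i l σ := by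
    intro σ
    have := congrFun (sign_eq_rootForm (k := k) r hall) σ
    rw [rootForm_comm r l r, rootForm_comm r j r, rootForm_root, rootForm_root] at this
    rw [rootForm_comm r i j, rootForm_comm r i l]
    simpa using this
  simp_rw [e, sub_smul] at h
  rw [Finset.sum_sub_distrib, sub_eq_zero] at h
  exact h

open Classical in
/-- Modulo the standard relations at its median vertex, the form of a pair depends only on this
vertex: pass from `i, j` to `i, i'` and from there to `i', j'`, or, if `i` and `i'` lie
on the same branch, from `i, j` to `i, j'`. -/
theorem sum_rootForm_of_median [Finite S]
    (hg : ∀ σ, ¬ IsFace (Insert.insert σ τ.splits) → g σ = 0) (hs : StandardRelationsHold τ g)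
    {r i j i' j' : S} {x : τ.graph.V} (h : τ.Median r i j x) (h' : τ.Median r i' j' x)
    (hi : i ∈ W) (hi' : i' ∈ W) (hr : r ∈ W) :
    ∑ σ ∈ τ.splitsᶜ, rootForm k r i j σ • g σ = ∑ σ ∈ τ.splitsᶜ, rootForm k r i' j' σ • g σ := by
  obtain ⟨I, J, R, hI, hJ, rfl, hIJ, hIR, hJR, hiI, hjJ, hrR⟩ := h
  obtain ⟨K, L, R', hK, hL, hR', hKL, hKR, hLR, hiK, hjL, hrR'⟩ := h'
  obtain rfl : R' = R := τ.stable.tree.flag_unique hR' hrR' hrR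
  by_cases hIK : I = K
  · subst hIK
    exact (sum_rootForm_of_common hg hs hI hJ hL hIJ hKL hIR hJR hLR hiI hjJ hjL hrR hi hr).trans
      (sum_rootForm_congr hg hI hL hKL hIR hLR hiI hiK hjL hjL hrR)
  · rw [sum_rootForm_of_common hg hs hI hJ hK hIJ hIK hIR hJR hKR hiI hjJ hiK hrR hi hr,
      rootForm_comm r i i']
    exact sum_rootForm_of_common hg hs hK hI hL (Ne.symm hIK) hKL hKR hIR hLR hiK hiI hjL hrR hi' hr

open Classical in
/-- The relation between the trees with one more edge than `τ`, given by a linear form of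
`Λ` vanishing on the edges of `τ`, follows from the standard relations at the vertices of `τ`. -/
theorem sum_smul_eq_zero [Finite S]
    (hg : ∀ σ, ¬ IsFace (Insert.insert σ τ.splits) → g σ = 0) (hs : StandardRelationsHold τ g)
    (hW : W.Nonempty) {m : StablePartition W → k} (hm : m ∈ signForms k W)
    (h0 : ∀ σ ∈ τ.splits, m σ = 0) : ∑ σ ∈ τ.splitsᶜ, m σ • g σ = 0 := by
  have hG := τ.stable.tree
  have := τ.graph.finite_V
  have := Fintype.ofFinite τ.graph.V
  obtain ⟨r, hr⟩ := hW
  obtain ⟨c, hc, hmc⟩ := balanced_of_mem_signForms r hm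
  choose R hR hrR using fun x => hG.exists_flag x r
  choose ν hν using fun p : RootPair W r =>
    exists_median (τ := τ) (r := r) (i := p.1.1) (j := p.1.2) p.2.2.1 p.2.2.2.1 p.2.2.2.2
  -- a pair lies below `x` if and only if its median vertex does
  have inside : ∀ (p : RootPair W r) (x : τ.graph.V),
      (p.1.1 ∉ τ.graph.branch (R x) ∧ p.1.2 ∉ τ.graph.branch (R x)) ↔
        τ.graph.branch (R x) ⊆ τ.graph.branch (R (ν p)) := by
    intro p x
    obtain ⟨I, J, R', hI, hJ, hR', hIJ, hIR, hJR, hiI, hjJ, hrR'⟩ := hν p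
    obtain rfl : R' = R (ν p) := hG.flag_unique (hR'.trans (hR _).symm) hrR' (hrR _)
    constructor
    · rintro ⟨h1, h2⟩
      by_cases ht : τ.graph.inv (R x) = R x
      · obtain ⟨s, hs⟩ := exists_label ht
        have h := hrR x
        rw [← hs, branch_label, Set.mem_singleton_iff] at h
        rw [← hs, branch_label, ← h, Set.singleton_subset_iff]
        exact hrR'
      · obtain ⟨q, hq, h | h⟩ := hG.exists_subset_or ht (ν p)
        · have : q = R (ν p) := hG.flag_unique (hq.trans hR'.symm) (h (hrR x)) hrR'
          rwa [this] at h
        · exact absurd ((hG.flag_unique (hq.trans hI.symm) (h h1) hiI).symm.trans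
            (hG.flag_unique (hq.trans hJ.symm) (h h2) hjJ)) hIJ
    · intro h
      exact ⟨fun h' => τ.subset_compl_branch (hI.trans hR'.symm) hIR hiI (h h'),
        fun h' => τ.subset_compl_branch (hJ.trans hR'.symm) hJR hjJ (h h')⟩
  -- the value of `m` at the edge above `x` is the sum over all pairs below `x`; if `x` carries the
  -- tail `r`, these are all pairs
  have total : ∀ x : τ.graph.V,
      ∑ p with τ.graph.branch (R x) ⊆ τ.graph.branch (R (ν p)), c p = 0 := by
    intro x
    by_cases ht : τ.graph.inv (R x) = R x
    · rw [← hc, Finset.filter_true_of_mem]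
      intro p _
      rw [← inside]
      obtain ⟨s, hs⟩ := exists_label ht
      have h := hrR x
      rw [← hs, branch_label, Set.mem_singleton_iff] at h
      rw [← hs, branch_label, ← h]
      exact ⟨p.2.2.2.1, p.2.2.2.2⟩
    · have h1 := h0 _ (mem_splits.2 ⟨R x, ht, edgePartition_isPart ht⟩)
      rw [← h1, hmc, Finset.sum_apply, Finset.sum_filter]
      refine Finset.sum_congr rfl fun p _ => ?_
      have h2 := separates_root_iff (edgePartition_isPart ht).compl (r := r)
        (fun h => h (hrR x)) (i := p.1.1) (j := p.1.2)
      simp only [Set.mem_compl_iff, inside] at h2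
      simp only [Pi.smul_apply, RootPair.form, rootForm, h2, smul_eq_mul, mul_ite, mul_one,
        mul_zero]
  have fibre : ∀ x : τ.graph.V, ∑ p with ν p = x, c p = 0 := by
    suffices H : ∀ (n : ℕ) (x : τ.graph.V), ((τ.graph.branch (R x))ᶜ).ncard = n →
        ∑ p with ν p = x, c p = 0 from fun x => H _ x rfl
    intro n
    induction n using Nat.strong_induction_on with
    | _ n ih =>
      rintro x rfl
      have t := (Finset.sum_fiberwise _ ν _).trans (total x)
      rw [Finset.sum_eq_single x] at t
      · rw [← t, Finset.filter_filter]
        refine Finset.sum_congr (Finset.filter_congr fun p _ => ?_) fun _ _ => rfl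
        exact ⟨fun h => ⟨by rw [h], h⟩, fun h => h.2⟩
      · intro y _ hy
        rw [Finset.filter_filter]
        by_cases hxy : τ.graph.branch (R x) ⊆ τ.graph.branch (R y)
        · rw [← ih _ (Set.ncard_lt_ncard ((Set.compl_subset_compl.2 hxy).ssubset_of_ne
            fun e => hy ?_) (Set.toFinite _)) y rfl]
          · refine Finset.sum_congr (Finset.filter_congr fun p _ => ?_) fun _ _ => rfl
            exact ⟨fun h => h.2, fun h => ⟨by rw [h]; exact hxy, h⟩⟩
          · rw [← hR y, ← hR x, τ.branch_injective (compl_injective e)]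
        · refine Finset.sum_eq_zero fun p hp => absurd ?_ hxy
          obtain ⟨-, h1, h2⟩ := Finset.mem_filter.1 hp
          rwa [h2] at h1
      · exact fun h => absurd (Finset.mem_univ _) h
  have expand : ∑ σ ∈ τ.splitsᶜ, m σ • g σ =
      ∑ p, c p • ∑ σ ∈ τ.splitsᶜ, p.form k σ • g σ := by
    simp_rw [hmc, Finset.smul_sum]
    rw [Finset.sum_comm]
    refine Finset.sum_congr rfl fun σ _ => ?_
    rw [Finset.sum_apply, Finset.sum_smul]
    exact Finset.sum_congr rfl fun p _ => by rw [Pi.smul_apply, smul_assoc]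
  rw [expand, ← Finset.sum_fiberwise _ ν]
  refine Finset.sum_eq_zero fun x _ => ?_
  by_cases hx : ∃ q, ν q = x
  · obtain ⟨q, rfl⟩ := hx
    rw [Finset.sum_congr rfl (g := fun p => c p • ∑ σ ∈ τ.splitsᶜ, q.form k σ • g σ),
      ← Finset.sum_smul, fibre, zero_smul]
    intro p hp
    have hp := (Finset.mem_filter.1 hp).2
    have h1 := hν p
    rw [hp] at h1
    exact congrArg _ (sum_rootForm_of_median hg hs h1 (hν q) p.2.1 q.2.1 hr)
  · refine Finset.sum_eq_zero fun p hp => absurd ⟨p, (Finset.mem_filter.1 hp).2⟩ hx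

end

end PSTree

/-! ### Good monomials -/

variable (k) in
/-- The class of the square-free monomial of a set of partitions. -/
noncomputable def faceMonomial [Finite S] (F : Finset (StablePartition W)) : Cohomology k W :=
  ∏ σ ∈ F, lClass k σ

theorem lClass_mul_of_cross [Finite S] {σ σ' : StablePartition W} (h : σ.Cross σ') :
    lClass k σ * lClass k σ' = 0 := by
  obtain ⟨a, b, c, d, h1, h2, h3⟩ := h
  rw [lClass, lClass, ← map_mul, Ideal.Quotient.eq_zero_iff_mem]
  exact Ideal.subset_span (Or.inr ⟨σ, σ', a, b, c, d, h1, h2, h3, rfl⟩)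

theorem sum_sign_smul_lClass [Finite S] (a b c d : S) :
    ∑ σ : StablePartition W, sign k σ a b c d • lClass k σ = 0 := by
  have : Ideal.Quotient.mk (relIdeal k W) (linRel k W a b c d) = 0 :=
    Ideal.Quotient.eq_zero_iff_mem.2 (Ideal.subset_span (Or.inl ⟨a, b, c, d, rfl⟩))
  rw [← this, linRel, map_sum]
  refine Finset.sum_congr rfl fun σ _ => ?_
  rw [MvPolynomial.C_mul', lClass]
  rfl

theorem sum_smul_lClass [Finite S] {m : StablePartition W → k} (hm : m ∈ signForms k W) :
    ∑ σ, m σ • lClass k σ = 0 := by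
  induction hm using Submodule.span_induction with
  | mem m h => obtain ⟨a, b, c, d, rfl⟩ := h; exact sum_sign_smul_lClass a b c d
  | zero => simp
  | add m m' _ _ h h' => simp [add_smul, Finset.sum_add_distrib, h, h']
  | smul a m _ h => simp [mul_smul, ← Finset.smul_sum, h]

theorem faceMonomial_eq_zero [Finite S] {F : Finset (StablePartition W)} (hF : ¬ IsFace F) :
    faceMonomial k F = 0 := by
  classical
  simp only [IsFace, not_forall, not_not] at hF
  obtain ⟨σ, hσ, σ', hσ', h⟩ := hF
  have hne : σ ≠ σ' := by rintro rfl; exact not_cross_self σ h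
  rw [faceMonomial, ← Finset.mul_prod_erase _ _ hσ,
    ← Finset.mul_prod_erase _ _ (Finset.mem_erase.2 ⟨hne.symm, hσ'⟩), ← mul_assoc,
    lClass_mul_of_cross h, zero_mul]

theorem adjoin_lClass [Finite S] : Algebra.adjoin k (Set.range (lClass (W := W) k)) = ⊤ := by
  have h := MvPolynomial.adjoin_range_X (R := k) (σ := StablePartition W)
  have h2 := congrArg (Subalgebra.map (Ideal.Quotient.mkₐ k (relIdeal k W))) h
  rw [AlgHom.map_adjoin, Algebra.map_top, ← Set.range_comp] at h2
  rw [(AlgHom.range_eq_top _).2 (Ideal.Quotient.mkₐ_surjective k _)] at h2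
  exact h2

theorem span_faceMonomial [Finite S] (h3 : 3 ≤ Nat.card S) (hW : W.Nonempty) :
    Submodule.span k (Set.range fun τ : PSTree W => faceMonomial k τ.splits) = ⊤ := by
  classical
  rw [eq_top_iff, ← span_prod_faces (hasDuals h3 hW k) (fun m hm => sum_smul_lClass hm)
    (fun F hF => faceMonomial_eq_zero hF) adjoin_lClass]
  refine Submodule.span_mono ?_
  rintro _ ⟨F, hF, rfl⟩
  obtain ⟨τ, rfl⟩ := exists_splits_eq h3 hW F hF
  exact ⟨τ, rfl⟩

/-- The isomorphism class of a tree. -/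
def PSTree.toClass (τ : PSTree W) : TreeClass W := Quotient.mk (treeSetoid W) τ

theorem exists_toClass_eq (t : TreeClass W) : ∃ τ : PSTree W, τ.toClass = t := Quotient.exists_rep t

theorem mu_eq (τ : PSTree W) : mu k τ = Finsupp.single τ.toClass 1 := rfl

theorem goodMonomial_toClass (τ : PSTree W) : goodMonomial k τ.toClass = τ.monomial k := rfl

/-- The linear map that takes a tree to the class of its good monomial. -/
noncomputable def monomialMap (k : Type v) [CommRing k] [Finite S] (W : Set S) :
    FreeTrees k W →ₗ[k] Cohomology k W :=
  (Ideal.Quotient.mkₐ k (relIdeal k W)).toLinearMap ∘ₗ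
    Finsupp.linearCombination k (goodMonomial k)

open Classical in
theorem monomial_eq_prod (τ : PSTree W) : τ.monomial k = ∏ σ ∈ τ.splits, gen k σ := by
  rw [splits, Finset.prod_image fun _ _ _ _ h => edgePartition_injective h]
  rfl

theorem monomialMap_mu [Finite S] (τ : PSTree W) :
    monomialMap k W (mu k τ) = faceMonomial k τ.splits := by
  rw [monomialMap, mu_eq, LinearMap.comp_apply, Finsupp.linearCombination_single, one_smul,
    goodMonomial_toClass, monomial_eq_prod, faceMonomial]
  exact map_prod (Ideal.Quotient.mkₐ k (relIdeal k W)) _ _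

open Classical in
theorem monomialMap_cutSum [Finite S] (τ : PSTree W) (x : τ.graph.V) (I J K L : τ.graph.F) :
    monomialMap k W (cutSum k τ x I J K L) = ∑ α : VertexPartition τ x,
      if α.Separates I J K L
        then faceMonomial k (Insert.insert (τ.vertexPartition α) τ.splits) else 0 := by
  rw [cutSum, map_sum]
  refine Finset.sum_congr rfl fun α _ => ?_
  rw [apply_ite (monomialMap k W), map_zero, monomialMap_mu, α.splits_insert]

/-- The standard relation at a vertex is a linear relation of the cohomology ring multiplied by the
good monomial of the tree. -/
theorem standardRelations_le_ker [Finite S] :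
    standardRelations k W ≤ LinearMap.ker (monomialMap k W) := by
  classical
  refine Submodule.span_le.2 ?_
  rintro _ ⟨τ, x, I, J, K, L, hx, hnd, ⟨a, ha, b, hb, c, hc, d, hd, hall⟩, rfl⟩
  simp only [List.forall_mem_cons, List.not_mem_nil, false_imp_iff, implies_true, and_true] at hx
  obtain ⟨hI, hJ, hK, hL⟩ := hx
  rw [SetLike.mem_coe, LinearMap.mem_ker, map_sub, monomialMap_cutSum, monomialMap_cutSum]
  rw [← sum_sign_smul (k := k) (fun σ hσ => faceMonomial_eq_zero hσ) hI hJ hK hL hnd ha hb hc hd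
    hall]
  refine sum_smul_prod_insert (sum_sign_smul_lClass a b c d) fun σ hσ => ?_
  simp only [List.nodup_cons, List.mem_cons, List.not_mem_nil, or_false, not_or, not_false_eq_true,
    List.nodup_nil, and_true] at hnd
  obtain ⟨⟨hIJ, hIK, hIL⟩, ⟨hJK, hJL⟩, hKL⟩ := hnd
  subst hI
  exact sign_eq_zero (not_separates_of_mem_splits hσ hJ hK hL hIJ hKL ha hb hc hd)
    (not_separates_of_mem_splits hσ (hJ.trans hK.symm) hK.symm (hL.trans hK.symm) (Ne.symm hJK)
      hIL hc hb ha hd)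

/-! ### From faces to homology -/

open Classical in
variable (k) in
/-- The homology class of the tree with the given set of edge partitions, and zero if there is no
such tree. -/
noncomputable def treeClass (F : Finset (StablePartition W)) : Homology k W :=
  if h : ∃ τ : PSTree W, τ.splits = F then muClass k h.choose else 0

theorem treeClass_splits (τ : PSTree W) : treeClass k τ.splits = muClass k τ := by
  have h : ∃ τ' : PSTree W, τ'.splits = τ.splits := ⟨τ, rfl⟩
  rw [treeClass, dif_pos h, muClass, muClass, mu, mu]
  congr 2
  exact Quotient.sound (nonempty_iso_of_splits_eq h.choose_spec)

theorem treeClass_eq_zero {F : Finset (StablePartition W)} (hF : ¬ IsFace F) :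
    treeClass k F = 0 := by
  refine dif_neg ?_
  rintro ⟨τ, rfl⟩
  exact hF isFace_splits

open Classical in
theorem toHomology_cutSum (τ : PSTree W) (x : τ.graph.V) (I J K L : τ.graph.F) :
    toHomology k W (cutSum k τ x I J K L) = ∑ α : VertexPartition τ x,
      if α.Separates I J K L
        then treeClass k (Insert.insert (τ.vertexPartition α) τ.splits) else 0 := by
  rw [cutSum, map_sum]
  refine Finset.sum_congr rfl fun α _ => ?_
  rw [apply_ite (toHomology k W), map_zero, ← α.splits_insert, treeClass_splits]
  rfl

open Classical in
theorem standardRelationsHold_treeClass (τ : PSTree W) :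
    StandardRelationsHold τ fun σ => treeClass k (Insert.insert σ τ.splits) := by
  intro x I J K L hx hnd hall
  rw [← toHomology_cutSum, ← toHomology_cutSum, ← sub_eq_zero, ← map_sub]
  exact (Submodule.Quotient.mk_eq_zero _).2
    (Submodule.subset_span ⟨τ, x, I, J, K, L, hx, hnd, hall, rfl⟩)

open Classical in
/-- The relations between faces hold in homology. -/
theorem faceRelations_le_ker_treeClass [Finite S] (h3 : 3 ≤ Nat.card S) (hW : W.Nonempty) :
    faceRelations IsFace (signForms k W) ≤
      LinearMap.ker (Finsupp.linearCombination k (treeClass (W := W) k)) := by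
  refine Submodule.span_le.2 ?_
  rintro _ (⟨F, hF, rfl⟩ | ⟨F, m, hm, h0, rfl⟩)
  · rw [SetLike.mem_coe, LinearMap.mem_ker, Finsupp.linearCombination_single, one_smul,
      treeClass_eq_zero hF]
  simp only [SetLike.mem_coe, LinearMap.mem_ker, map_sum, map_smul,
    Finsupp.linearCombination_single, one_smul]
  by_cases hF : IsFace F
  · obtain ⟨τ, rfl⟩ := exists_splits_eq h3 hW F hF
    exact sum_smul_eq_zero (fun σ hσ => treeClass_eq_zero hσ)
      (standardRelationsHold_treeClass τ) hW hm h0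
  · refine Finset.sum_eq_zero fun σ _ => ?_
    rw [treeClass_eq_zero fun h => hF (h.mono (Finset.subset_insert _ _)), smul_zero]

open Classical in
theorem exists_faceModule_map [Finite S] (h3 : 3 ≤ Nat.card S) (hW : W.Nonempty) :
    ∃ Φ : FaceModule (IsFace (W := W)) (signForms k W) →ₗ[k] Homology k W,
      ∀ F, Φ (faceClass _ _ F) = treeClass k F := by
  let φ : (Finset (StablePartition W) →₀ k) →ₗ[k] Homology k W :=
    Finsupp.linearCombination k (treeClass (W := W) k)
  have hφ : faceRelations IsFace (signForms k W) ≤ LinearMap.ker φ :=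
    faceRelations_le_ker_treeClass h3 hW
  have hφ1 : ∀ F, φ (Finsupp.single F 1) = treeClass k F := fun F => by
    rw [Finsupp.linearCombination_single, one_smul]
  exact ⟨(faceRelations IsFace (signForms k W)).liftQ φ hφ, hφ1⟩

/-- The map from the cohomology ring through the module of face classes to homology takes the good
monomial of a tree back to the class of the tree. -/
theorem ker_le_standardRelations [Finite S] (h3 : 3 ≤ Nat.card S) (hW : W.Nonempty) :
    LinearMap.ker (monomialMap k W) ≤ standardRelations k W := by
  classical
  obtain ⟨Φ, hΦ⟩ := exists_faceModule_map (k := k) h3 hW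
  obtain ⟨Ψ, hΨ0, hΨ⟩ := exists_faceClass_map (fun _ _ h hG => IsFace.mono h hG) (hasDuals h3 hW k)
    (relIdeal k W) _ rfl (by
      rintro p (⟨a, b, c, d, rfl⟩ | ⟨σ, σ', a, b, c, d, h1, h2, h3, rfl⟩)
      · exact Or.inl ⟨_, Submodule.subset_span ⟨a, b, c, d, rfl⟩, rfl⟩
      · have hc : σ.Cross σ' := ⟨a, b, c, d, h1, h2, h3⟩
        refine Or.inr ⟨σ, σ', ?_, fun h => h σ (by simp) σ' (by simp) hc, rfl⟩
        rintro rfl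
        exact not_cross_self σ hc)
  have key : (Φ ∘ₗ Ψ) ∘ₗ Finsupp.linearCombination k (goodMonomial k) = toHomology k W := by
    refine Finsupp.lhom_ext' fun t => LinearMap.ext_ring ?_
    obtain ⟨τ, rfl⟩ := exists_toClass_eq t
    simp only [LinearMap.comp_apply, Finsupp.lsingle_apply, Finsupp.linearCombination_single,
      one_smul, goodMonomial_toClass, monomial_eq_prod, hΨ, hΦ, treeClass_splits]
    rfl
  intro f hf
  have hmem : Finsupp.linearCombination k (goodMonomial k) f ∈ relIdeal k W :=
    Ideal.Quotient.eq_zero_iff_mem.1 hf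
  have := LinearMap.congr_fun key f
  rw [LinearMap.comp_apply, LinearMap.comp_apply, hΨ0 _ hmem, map_zero] at this
  exact (Submodule.Quotient.mk_eq_zero _).1 this.symm

/-! ### The action -/

theorem span_muClass : Submodule.span k (Set.range (muClass (W := W) k)) = ⊤ := by
  rw [eq_top_iff]
  rintro x -
  obtain ⟨x, rfl⟩ := Submodule.mkQ_surjective _ x
  induction x using Finsupp.induction_linear with
  | zero => rw [map_zero]; exact zero_mem _
  | add x y hx hy => rw [map_add]; exact add_mem hx hy
  | single t a =>
    obtain ⟨τ, rfl⟩ := exists_toClass_eq t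
    have h : Finsupp.single τ.toClass a = a • mu k τ := by
      rw [mu_eq, Finsupp.smul_single, smul_eq_mul, mul_one]
    rw [h, map_smul]
    exact Submodule.smul_mem _ _ (Submodule.subset_span ⟨τ, rfl⟩)

/-- The map from trees to good monomials induces an isomorphism of homology with cohomology. -/
theorem exists_homologyEquiv [Finite S] (h3 : 3 ≤ Nat.card S) (hW : W.Nonempty) :
    ∃ e : Homology k W ≃ₗ[k] Cohomology k W, ∀ f, e (toHomology k W f) = monomialMap k W f := by
  have hker := le_antisymm (ker_le_standardRelations (k := k) h3 hW) standardRelations_le_ker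
  refine ⟨LinearEquiv.ofBijective ((standardRelations k W).liftQ (monomialMap k W)
    standardRelations_le_ker) ⟨?_, ?_⟩, fun f => rfl⟩
  · rw [← LinearMap.ker_eq_bot]
    exact Submodule.ker_liftQ_eq_bot _ _ _ hker.le
  · rw [← LinearMap.range_eq_top, Submodule.range_liftQ, eq_top_iff, ← span_faceMonomial h3 hW,
      Submodule.span_le]
    rintro _ ⟨τ, rfl⟩
    exact ⟨mu k τ, monomialMap_mu τ⟩

theorem aroundEdge_of_flags {τ : PSTree W} {f I J K L : τ.graph.F} (hf : τ.graph.inv f ≠ f)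
    (hIJ : ∀ g ∈ [I, J], τ.graph.bd g = τ.graph.bd f) (hnd : [I, J, f].Nodup)
    (hKL : ∀ g ∈ [K, L], τ.graph.bd g = τ.graph.bd (τ.graph.inv f))
    (hnd' : [K, L, τ.graph.inv f].Nodup) (hall : AllowedFlags τ I J K L) :
    ∃ a b c d, AroundEdge τ f I J K L a b c d := by
  obtain ⟨a, ha, b, hb, c, hc, d, hd, h⟩ := hall
  simp only [List.nodup_cons, List.mem_cons, List.not_mem_nil, or_false, not_or, not_false_eq_true,
    List.nodup_nil, and_true] at hnd hnd'
  exact ⟨a, b, c, d, hf, hIJ I (by simp), hIJ J (by simp), hKL K (by simp), hKL L (by simp),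
    hnd.1.2, hnd.2, hnd'.1.2, hnd'.2, hnd.1.1, hnd'.1.1, ha, hb, hc, hd, h⟩

/-- The product of a good monomial with one of its own variables, by the linear relation of a
quadruple around the corresponding edge. -/
theorem PSTree.AroundEdge.lClass_mul [Finite S] {τ : PSTree W} {f I J K L : τ.graph.F} {a b c d : S}
    (h : AroundEdge τ f I J K L a b c d) {σ : StablePartition W}
    (hσ : σ.IsPart (τ.graph.branch f)) :
    lClass k σ * faceMonomial k τ.splits = monomialMap k W (- cutSum k τ (τ.graph.bd f) I J f f
        - cutSum k τ (τ.graph.bd (τ.graph.inv f)) K L (τ.graph.inv f) (τ.graph.inv f)) := by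
  classical
  rw [map_sub, map_neg, monomialMap_cutSum, monomialMap_cutSum, ← neg_add',
    ← h.sum_sign_smul (k := k) fun σ hσ => faceMonomial_eq_zero hσ]
  exact mul_prod_of_mem (sum_sign_smul_lClass a b c d) (mem_splits.2 ⟨f, h.ne, hσ⟩)
    (h.sign_eq_one hσ) (fun σ' hσ' hne => h.sign_eq_zero_of_ne hσ hσ' hne)

theorem isTreeAction_of_mul [Finite S] {ρ : Cohomology k W →ₐ[k] Module.End k (Homology k W)}
    (e : Homology k W ≃ₗ[k] Cohomology k W)
    (he : ∀ f, e (toHomology k W f) = monomialMap k W f) (hρ : ∀ a x, e (ρ a x) = a * e x) :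
    IsTreeAction k ρ := by
  classical
  have hmu : ∀ τ : PSTree W, e (muClass k τ) = faceMonomial k τ.splits := fun τ =>
    (he _).trans (monomialMap_mu τ)
  refine ⟨fun σ τ h1 h2 => ?_, fun σ τ x α hα => ?_, fun σ τ f hf hσ I J K L h1 h2 h3 h4 h5 => ?_⟩
  · have hσ : σ ∉ τ.splits := by
      intro h
      obtain ⟨f, -, rfl⟩ := Finset.mem_image.1 h
      exact h1 f rfl
    apply e.injective
    rw [hρ, hmu, map_zero, faceMonomial, ← Finset.prod_insert hσ]
    refine faceMonomial_eq_zero fun hF => ?_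
    obtain ⟨x, α, hα⟩ := exists_vertexPartition_of_isFace hF hσ
    exact h2 x α hα
  · subst hα
    apply e.injective
    rw [hρ, hmu, hmu, α.splits_insert, faceMonomial, faceMonomial,
      Finset.prod_insert α.notMem_splits]
  · subst hσ
    obtain ⟨a, b, c, d, h⟩ := aroundEdge_of_flags hf h1 h2 h3 h4 h5
    apply e.injective
    rw [hρ, hmu, he]
    exact h.lClass_mul (edgePartition_isPart hf)

/-- For each `σ` and `τ` one of the three formulas applies, since for every edge there is an allowed
choice of flags. -/
theorem IsTreeAction.unique [Finite S] {ρ ρ' : Cohomology k W →ₐ[k] Module.End k (Homology k W)}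
    (h : IsTreeAction k ρ) (h' : IsTreeAction k ρ') : ρ' = ρ := by
  refine Ideal.Quotient.algHom_ext _ (MvPolynomial.algHom_ext fun σ => ?_)
  refine LinearMap.ext_on_range span_muClass fun τ => ?_
  change ρ' (lClass k σ) (muClass k τ) = ρ (lClass k σ) (muClass k τ)
  by_cases h1 : ∃ e, τ.edgePartition e = σ
  · obtain ⟨⟨_, f, hf, rfl⟩, hσ⟩ := h1
    obtain ⟨I, J, K, L, a, b, c, d, H⟩ := exists_aroundEdge hf
    have hI : ∀ g ∈ [I, J], τ.graph.bd g = τ.graph.bd f := by simp [H.bd_I, H.bd_J]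
    have hK : ∀ g ∈ [K, L], τ.graph.bd g = τ.graph.bd (τ.graph.inv f) := by simp [H.bd_K, H.bd_L]
    have hnd : [I, J, f].Nodup := by simp [H.I_ne_J, H.I_ne, H.J_ne]
    have hnd' : [K, L, τ.graph.inv f].Nodup := by simp [H.K_ne_L, H.K_ne, H.L_ne]
    have hall : AllowedFlags τ I J K L :=
      ⟨a, H.mem_I, b, H.mem_J, c, H.mem_K, d, H.mem_L, H.allowed⟩
    rw [h.break_edge σ τ f hf hσ I J K L hI hnd hK hnd' hall,
      h'.break_edge σ τ f hf hσ I J K L hI hnd hK hnd' hall]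
  by_cases h2 : ∃ (x : τ.graph.V) (α : VertexPartition τ x), τ.vertexPartition α = σ
  · obtain ⟨x, α, hα⟩ := h2
    rw [h.break_vertex σ τ x α hα, h'.break_vertex σ τ x α hα]
  · push Not at h1 h2
    rw [h.not_break σ τ h1 h2, h'.not_break σ τ h1 h2]

end PaintedTrees

theorem theorem2p3 {S : Type u} [Finite S] (h3 : 3 ≤ Nat.card S) (W : Set S) (hW : W.Nontrivial)
    (k : Type v) [CommRing k] :
    ∃ ρ : PaintedTrees.Cohomology k W →ₐ[k] Module.End k (PaintedTrees.Homology k W),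
      PaintedTrees.IsTreeAction k ρ ∧
      (∀ ρ', PaintedTrees.IsTreeAction k ρ' → ρ' = ρ) ∧
      Function.Bijective (fun a : PaintedTrees.Cohomology k W =>
        ρ a (PaintedTrees.muClass k (PaintedTrees.PSTree.point h3 hW.nonempty))) ∧
      LinearMap.ker ((Ideal.Quotient.mkₐ k (PaintedTrees.relIdeal k W)).toLinearMap ∘ₗ
        Finsupp.linearCombination k (PaintedTrees.goodMonomial k)) =
          PaintedTrees.standardRelations k W := by
  obtain ⟨e, he⟩ := PaintedTrees.exists_homologyEquiv (k := k) h3 hW.nonempty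
  let ρ : PaintedTrees.Cohomology k W →ₐ[k] Module.End k (PaintedTrees.Homology k W) :=
    ((e.symm.conjAlgEquiv k).toAlgHom).comp (Algebra.lmul k (PaintedTrees.Cohomology k W))
  have hρ : ∀ a x, e (ρ a x) = a * e x := fun a x => e.apply_symm_apply _
  have hone : e (PaintedTrees.muClass k (PaintedTrees.PSTree.point h3 hW.nonempty)) = 1 := by
    refine (he _).trans ?_
    rw [PaintedTrees.monomialMap_mu, PaintedTrees.PSTree.splits_point]
    exact Finset.prod_empty
  have hact := PaintedTrees.isTreeAction_of_mul e he hρ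
  refine ⟨ρ, hact, fun ρ' h' => hact.unique h', ?_,
    le_antisymm (PaintedTrees.ker_le_standardRelations h3 hW.nonempty)
      PaintedTrees.standardRelations_le_ker⟩
  have : (fun a : PaintedTrees.Cohomology k W =>
      ρ a (PaintedTrees.muClass k (PaintedTrees.PSTree.point h3 hW.nonempty))) = e.symm := by
    funext a
    apply e.injective
    rw [hρ, hone, mul_one, e.apply_symm_apply]
  rw [this]
  exact e.symm.bijective
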